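/- Let $d\ge 1$, let $\mathcal S$ be the set of density matrices on $\mathbb C^d$, let $\mathcal X$ be a measurable space and let $P$ be a positive operator-valued measure (POVM) on $\mathcal X$ with values in the positive semidefinite $d\times d$ matrices, $P(\mathcal X)=I$. Let $\Theta$ be a nonempty compact metric space, let $\theta\mapsto\rho_\theta\in\mathcal S$ be continuous, and let $\mathcal P(\Theta)$ be the set of Borel probability measures on $\Theta$ (priors) with the weak topology. Let $f:[0,1]\to\mathbb R$ be strictly convex and $C^1$ on $[0,1]$ (with one-sided derivatives at the endpoints), and let $$D_f(\rho,\sigma)=\operatorname{Tr}\bigl(f(\rho)-f(\sigma)-f'(\sigma)(\rho-\sigma)\bigr),\qquad \rho,\sigma\in\mathcal S .$$ An estimator is a measurable map $\hat\rho:\mathcal X\to\mathcal S$; its risk at $\theta$ is $R(\rho_\theta,\hat\rho)=\int_{\mathcal X} D_f(\rho_\theta,\hat\rho(x))\,dp_\theta(x)$, where $p_\theta(B)=\operatorname{Tr}(P(B)\rho_\theta)$. Then $P$ has a density: there are a probability measure $\nu$ on $\mathcal X$ and a measurable matrix-valued function $M$ on $\mathcal X$ with $M(x)\ge 0$ and $\operatorname{Tr}M(x)=d$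 for all $x$, such that $P(B)=\int_B M\,d\nu$ for all measurable $B$. Fix any such density and put $p(x|\theta)=\operatorname{Tr}(M(x)\rho_\theta)$ and $p_\pi(x)=\int_\Theta p(x|\theta)\,d\pi(\theta)$ for $\pi\in\mathcal P(\Theta)$. A Bayes estimator for the prior $\pi$ is an estimator $\hat\rho_B^\pi$ with $$\hat\rho_B^{\pi}(x)=\int_\Theta \frac{p(x|\theta)}{p_\pi(x)}\,\rho_\theta\,d\pi(\theta)\quad\text{for every }x\text{ with }p_\pi(x)>0$$ (its value is not determined where $p_\pi(x)=0$). There exists $\mu\in\mathcal P(\Theta)$ such that $p_\mu(x)>0$ for every outcome $x$ that satisfies $p(x|\theta)>0$ for at least one $\theta\in\Theta$. For every such $\mu$, put $$\mathcal P_{\mu/n}=\Bigl\{\tfrac{\mu}{n}+\bigl(1-\tfrac1n\bigr)\pi \;:\; \pi\in\mathcal P(\Theta)\Bigr\},\qquad n\ge 1 .$$ Then for every estimator $\hat\rho$ there exist priors $\pi_n\in\mathcal P_{\mu/n}$ ($n\ge1$) that converge weakly to some $\pi_\infty\in\mathcal P(\Theta)$, Bayes estimators $\hat\rho_B^{\pi_n}$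 for the priors $\pi_n$, and an estimator $\hat\rho_\infty$ such that $\hat\rho_B^{\pi_n}(x)\to\hat\rho_\infty(x)$ for every $x\in\mathcal X$ and $$R(\rho_\theta,\hat\rho_\infty)\le R(\rho_\theta,\hat\rho)\qquad\text{for all }\theta\in\Theta .$$ -/

import Mathlib

open Set Filter Topology MeasureTheory
open scoped ENNReal ComplexOrder Matrix

/-- Density matrices (quantum states) on the finite-dimensional Hilbert space `ℂⁿ`, with the
topology of matrices. -/
abbrev DensityMatrix (n : Type*) [Fintype n] : Type _ :=
  {A : Matrix n n ℂ // A.PosSemidef ∧ A.trace = 1}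

/-- A positive operator-valued measure on `X`: a countably additive map from measurable sets to
positive semidefinite matrices, of total mass the identity. -/
structure POVM (X : Type*) [MeasurableSpace X] (n : Type*) [Fintype n] [DecidableEq n] where
  /-- the underlying countably additive matrix-valued set function -/
  toVectorMeasure : VectorMeasure X (Matrix n n ℂ)
  posSemidef : ∀ B : Set X, MeasurableSet B → (toVectorMeasure B).PosSemidef
  univ_eq_one : toVectorMeasure Set.univ = 1

/-- `(ν, M)` is an operator density of the POVM `P`: `P(B) = ∫_B M dν` (entrywise), where `ν` is a
probability measure and `M` takes positive semidefinite values of trace `d`. -/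
structure POVM.IsDensity {X : Type*} [MeasurableSpace X] {n : Type*} [Fintype n] [DecidableEq n]
    (P : POVM X n) (ν : Measure X) (M : X → Matrix n n ℂ) : Prop where
  isProbabilityMeasure : IsProbabilityMeasure ν
  measurable : ∀ i j, Measurable fun x => M x i j
  posSemidef : ∀ x, (M x).PosSemidef
  trace_eq : ∀ x, (M x).trace = (Fintype.card n : ℂ)
  apply_eq : ∀ B : Set X, MeasurableSet B → ∀ i j,
    P.toVectorMeasure B i j = ∫ x in B, M x i j ∂ν

theorem trace_mul_re_nonneg {n : Type*} [Fintype n] [DecidableEq n] {A B : Matrix n n ℂ}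
    (hA : A.PosSemidef) (hB : B.PosSemidef) : 0 ≤ (A * B).trace.re := by
  obtain ⟨C, rfl⟩ : ∃ C : Matrix n n ℂ, B = Cᴴ * C := by
    open scoped MatrixOrder Matrix.Norms.L2Operator in
    exact CStarAlgebra.nonneg_iff_eq_star_mul_self.mp hB.nonneg
  have h : (A * (Cᴴ * C)).trace = (C * A * Cᴴ).trace := by
    rw [← Matrix.mul_assoc, Matrix.trace_mul_comm, Matrix.mul_assoc]
  rw [h]
  exact (Complex.le_def.mp (hA.mul_mul_conjTranspose_same C).trace_nonneg).1

/-- Born's rule: the law `B ↦ Tr (P(B) ρ)` of the outcome when the state `ρ` is measured. -/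
noncomputable def POVM.born {X : Type*} [MeasurableSpace X] {n : Type*} [Fintype n] [DecidableEq n]
    (P : POVM X n) (ρ : DensityMatrix n) : Measure X :=
  Measure.ofMeasurable
    (fun B _ => ENNReal.ofReal ((P.toVectorMeasure B * ρ.1).trace.re))
    (by simp)
    (by
      intro B hB hd
      have h1 := P.toVectorMeasure.m_iUnion hB hd
      let φ : Matrix n n ℂ →+ ℝ :=
        { toFun := fun A => (A * ρ.1).trace.re
          map_zero' := by simp
          map_add' := by intro A C; simp [Matrix.add_mul] }
      have hφ : Continuous φ := by
        change Continuous fun A : Matrix n n ℂ => (A * ρ.1).trace.re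
        fun_prop
      have h2 := h1.map φ hφ
      have h3 : ∀ i, 0 ≤ φ (P.toVectorMeasure (B i)) := fun i =>
        trace_mul_re_nonneg (P.posSemidef _ (hB i)) ρ.2.1
      have h4 := ENNReal.ofReal_tsum_of_nonneg h3 h2.summable
      have h5 : ∑' i, φ (P.toVectorMeasure (B i)) = φ (P.toVectorMeasure (⋃ i, B i)) := h2.tsum_eq
      rw [h5] at h4
      exact h4)

/-- The Bregman divergence `D_f(ρ, σ) = Tr (f(ρ) - f(σ) - f'(σ)(ρ - σ))` of density matrices, for
`f` on `[0, 1]`; at the endpoints `f'` is the one-sided derivative. -/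
noncomputable def bregmanDiv {n : Type*} [Fintype n] [DecidableEq n] (f : ℝ → ℝ)
    (ρ σ : DensityMatrix n) : ℝ :=
  (cfc f ρ.1 - cfc f σ.1 - cfc (derivWithin f (Icc 0 1)) σ.1 * (ρ.1 - σ.1)).trace.re

/-- An estimator assigns, measurably, a density matrix to each outcome. -/
def IsEstimator {X : Type*} [MeasurableSpace X] {n : Type*} [Fintype n]
    (σ : X → DensityMatrix n) : Prop :=
  ∀ i j, Measurable fun x => (σ x).1 i j

/-- The risk `R(ρ, σ) = E_{X|ρ} [D_f(ρ, σ(X))]` of the estimator `σ` in the state `ρ`. -/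
noncomputable def risk {X : Type*} [MeasurableSpace X] {n : Type*} [Fintype n] [DecidableEq n]
    (P : POVM X n) (f : ℝ → ℝ) (ρ : DensityMatrix n) (σ : X → DensityMatrix n) : ℝ :=
  ∫ x, bregmanDiv f ρ (σ x) ∂(P.born ρ)

/-- The likelihood `p(x|θ) = Tr (M(x) ρ_θ)`. -/
noncomputable def likelihood {X n Θ : Type*} [Fintype n] (M : X → Matrix n n ℂ)
    (ρ : Θ → DensityMatrix n) (x : X) (θ : Θ) : ℝ :=
  (M x * (ρ θ).1).trace.re

/-- The marginal likelihood `p_π(x) = ∫ p(x|θ) dπ(θ)`. -/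
noncomputable def marginal {X n Θ : Type*} [Fintype n] [MeasurableSpace Θ] (M : X → Matrix n n ℂ)
    (ρ : Θ → DensityMatrix n) (π : ProbabilityMeasure Θ) (x : X) : ℝ :=
  ∫ θ, likelihood M ρ x θ ∂(π : Measure Θ)

/-- `σ` is a Bayes estimator for the prior `π`: an estimator equal to the posterior mean
`∫ (p(x|θ) / p_π(x)) ρ_θ dπ(θ)` (entrywise) at each outcome `x` with `p_π(x) > 0`; where
`p_π(x) = 0` its value is not determined. -/
def IsBayesEstimator {X n Θ : Type*} [MeasurableSpace X] [Fintype n] [MeasurableSpace Θ]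
    (M : X → Matrix n n ℂ) (ρ : Θ → DensityMatrix n) (π : ProbabilityMeasure Θ)
    (σ : X → DensityMatrix n) : Prop :=
  IsEstimator σ ∧ ∀ x, 0 < marginal M ρ π x → ∀ i j,
    (σ x).1 i j =
      ∫ θ, ((likelihood M ρ x θ / marginal M ρ π x : ℝ) : ℂ) * (ρ θ).1 i j ∂(π : Measure Θ)

/-- `p_μ(x) > 0` for every outcome `x` that has positive likelihood under some parameter. -/
def IsRegularizing {X n Θ : Type*} [Fintype n] [MeasurableSpace Θ] (M : X → Matrix n n ℂ)
    (ρ : Θ → DensityMatrix n) (μ : ProbabilityMeasure Θ) : Prop :=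
  ∀ x, (∃ θ, 0 < likelihood M ρ x θ) → 0 < marginal M ρ μ x

/-- The set `{μ/k + (1 - 1/k) τ | τ a probability measure}` of priors, for `k ≥ 1`. -/
def regularizedPriors {Θ : Type*} [MeasurableSpace Θ] (μ : ProbabilityMeasure Θ) (k : ℕ) :
    Set (ProbabilityMeasure Θ) :=
  {π | ∃ τ : ProbabilityMeasure Θ,
    (π : Measure Θ) = (k : ℝ≥0∞)⁻¹ • (μ : Measure Θ) + (1 - (k : ℝ≥0∞)⁻¹) • (τ : Measure Θ)}

/-!
This is a complete class theorem: every estimator is dominated by a limit of Bayes estimators.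

Write `S_π` for the Bayes estimator of a prior `π`. Fix `σ` and, for a prior `π` and an estimator
`κ`, let `A(κ, π)` be the `π`-average of `R(ρ_θ, σ) - R(ρ_θ, κ)`. A loss difference
`D_f(ρ, τ) - D_f(ρ, τ')` is affine in `ρ`, so its posterior average is its value at the posterior
mean; with Klein's inequality `D_f ≥ 0` (`bregmanDiv_nonneg`) this makes `S_π` maximize `A(·, π)`
(`POVM.IsDensity.integral_risk_bayesEstimator_le`). Hence `G(π) = A(S_π, π) ≥ 0` is a maximum of
functions that are affine and weakly continuous in `π`; it is lower semicontinuous and attains its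
minimum over the compact set of priors `a μ + b τ` at some `π*`. Moving from `π*` towards another
such prior `π'` with a small weight `t`, to a prior `π_t`, gives
`G(π*) ≤ A(S_{π_t}, π_t) ≤ (1 - t) G(π*) + t A(S_{π_t}, π')`, so `A(S_{π_t}, π') ≥ G(π*) ≥ 0`. Since
`μ` keeps all relevant marginal likelihoods positive, `S_{π_t} → S_{π*}` everywhere as `t → 0`, and
`A(S_{π*}, π') ≥ 0` for every `π'` (`POVM.IsDensity.exists_forall_integral_risk_sub_nonneg`). The
choice `π' = a μ + b δ_θ` shows that `S_{π*}` dominates `σ` at `θ` up to an error of order `a`,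
which vanishes for `a = 1/k`, `k → ∞`.

It remains to extract a limit estimator that is reached at *every* outcome, although the limiting
prior may give probability zero to uncountably many of them. The unnormalized posterior mean at `x`
is `L_π(M(x))` for the linear map `L_π(A) = ∫ Tr(A ρ_θ) ρ_θ dπ(θ)`. In finite dimension a sequence
of linear maps has a subsequence along which the image of each vector, suitably rescaled, converges
to a nonzero limit unless it vanishes identically (`exists_subseq_forall_tendsto_smul`).
Normalizing to trace one forgets the scale, so the Bayes estimators converge everywhere. Priors are
then repeated to keep the `k`-th one in the `k`-th regularized class.

The operator density of a POVM consists of the Radon–Nikodym derivatives of its matrix entries with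
respect to the outcome law of the maximally mixed state (`POVM.exists_isDensity`).
-/

/-! ### Density matrices -/

theorem Matrix.PosSemidef.norm_apply_le_trace {n : Type*} [Fintype n] [DecidableEq n]
    {A : Matrix n n ℂ} (hA : A.PosSemidef) (i j : n) : ‖A i j‖ ≤ A.trace.re := by
  obtain ⟨C, rfl⟩ : ∃ C : Matrix n n ℂ, A = Cᴴ * C := by
    open scoped MatrixOrder Matrix.Norms.L2Operator in
    exact CStarAlgebra.nonneg_iff_eq_star_mul_self.mp hA.nonneg
  have htr : (Cᴴ * C).trace.re = ∑ i, ∑ k, ‖C k i‖ ^ 2 := by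
    have h : (Cᴴ * C).trace = ((∑ i, ∑ k, ‖C k i‖ ^ 2 : ℝ) : ℂ) := by
      simp [Matrix.trace, Matrix.mul_apply, Complex.conj_mul']
    rw [h, Complex.ofReal_re]
  have hcol : ∀ i, ∑ k, ‖C k i‖ ^ 2 ≤ ∑ i, ∑ k, ‖C k i‖ ^ 2 := fun i =>
    Finset.single_le_sum (f := fun i => ∑ k, ‖C k i‖ ^ 2) (fun _ _ => by positivity)
      (Finset.mem_univ i)
  rw [htr, Matrix.mul_apply]
  refine (norm_sum_le _ _).trans ?_
  calc ∑ k, ‖Cᴴ i k * C k j‖ ≤ ∑ k, (‖C k i‖ ^ 2 + ‖C k j‖ ^ 2) / 2 := by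
        refine Finset.sum_le_sum fun k _ => ?_
        rw [norm_mul, Matrix.conjTranspose_apply, norm_star]
        linarith [two_mul_le_add_sq ‖C k i‖ ‖C k j‖]
    _ = (∑ k, ‖C k i‖ ^ 2 + ∑ k, ‖C k j‖ ^ 2) / 2 := by
        rw [← Finset.sum_div, Finset.sum_add_distrib]
    _ ≤ ∑ i, ∑ k, ‖C k i‖ ^ 2 := by linarith [hcol i, hcol j]

theorem Matrix.PosSemidef.trace_mul_nonneg {n : Type*} [Fintype n] [DecidableEq n]
    {A B : Matrix n n ℂ} (hA : A.PosSemidef) (hB : B.PosSemidef) : 0 ≤ (A * B).trace := by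
  obtain ⟨C, rfl⟩ : ∃ C : Matrix n n ℂ, B = Cᴴ * C := by
    open scoped MatrixOrder Matrix.Norms.L2Operator in
    exact CStarAlgebra.nonneg_iff_eq_star_mul_self.mp hB.nonneg
  rw [← Matrix.mul_assoc, Matrix.trace_mul_comm, ← Matrix.mul_assoc]
  exact (hA.mul_mul_conjTranspose_same C).trace_nonneg

/-- Over `ℂ` a matrix with nonnegative quadratic form is automatically Hermitian. -/
theorem Matrix.posSemidef_of_forall_dotProduct_mulVec_nonneg {n : Type*} [Fintype n]
    {A : Matrix n n ℂ} (hA : ∀ v, 0 ≤ star v ⬝ᵥ (A *ᵥ v)) : A.PosSemidef := by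
  classical
  rw [← Matrix.isPositive_toEuclideanLin_iff, LinearMap.isPositive_iff_complex]
  intro v
  have h : inner ℂ (A.toEuclideanLin v) v = star (star v.ofLp ⬝ᵥ (A *ᵥ v.ofLp)) := by
    rw [EuclideanSpace.inner_eq_star_dotProduct, Matrix.ofLp_toLpLin, Matrix.toLin'_apply,
      ← Matrix.star_dotProduct_star, star_star, dotProduct_comm]
  obtain ⟨h1, h2⟩ := Complex.nonneg_iff.mp (hA v.ofLp)
  rw [h]
  exact ⟨Complex.ext (by simp) (by simp [← h2]), by simpa using h1⟩

theorem isClosed_setOf_posSemidef {n : Type*} [Fintype n] :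
    IsClosed {A : Matrix n n ℂ | A.PosSemidef} := by
  have h : {A : Matrix n n ℂ | A.PosSemidef} =
      {A | A.IsHermitian} ∩ ⋂ v : n → ℂ, {A | 0 ≤ star v ⬝ᵥ (A *ᵥ v)} := by
    ext A
    simp [Matrix.posSemidef_iff_dotProduct_mulVec]
  rw [h]
  refine IsClosed.inter (isClosed_eq (by fun_prop) continuous_id)
    (isClosed_iInter fun v => isClosed_le continuous_const ?_)
  fun_prop

theorem isClosed_setOf_densityMatrix {n : Type*} [Fintype n] :
    IsClosed {A : Matrix n n ℂ | A.PosSemidef ∧ A.trace = 1} :=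
  isClosed_setOf_posSemidef.inter (isClosed_eq (by fun_prop) continuous_const)

instance DensityMatrix.instCompactSpace {n : Type*} [Fintype n] [DecidableEq n] :
    CompactSpace (DensityMatrix n) := by
  refine isCompact_iff_compactSpace.mp (IsCompact.of_isClosed_subset
    (s := (Set.univ.pi fun _ => Set.univ.pi fun _ =>
      Metric.closedBall (0 : ℂ) 1 : Set (n → n → ℂ))) ?_
    isClosed_setOf_densityMatrix ?_)
  · exact isCompact_univ_pi fun _ => isCompact_univ_pi fun _ => isCompact_closedBall _ _
  · intro A hA
    simp only [Set.mem_univ_pi, mem_closedBall_zero_iff]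
    exact fun i j => (hA.1.norm_apply_le_trace i j).trans_eq (by rw [hA.2, Complex.one_re])

theorem DensityMatrix.eigenvalues_mem_Icc {n : Type*} [Fintype n] [DecidableEq n]
    (ρ : DensityMatrix n) (i : n) : ρ.2.1.isHermitian.eigenvalues i ∈ Icc (0 : ℝ) 1 := by
  have hsum : ∑ i, ρ.2.1.isHermitian.eigenvalues i = 1 := by
    have h := ρ.2.1.isHermitian.trace_eq_sum_eigenvalues
    exact Complex.ofReal_injective (by simpa using h.symm.trans ρ.2.2)
  refine ⟨ρ.2.1.eigenvalues_nonneg i, hsum ▸ ?_⟩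
  exact Finset.single_le_sum (f := ρ.2.1.isHermitian.eigenvalues)
    (fun j _ => ρ.2.1.eigenvalues_nonneg j) (Finset.mem_univ i)

theorem DensityMatrix.spectrum_subset_Icc {n : Type*} [Fintype n] [DecidableEq n]
    (ρ : DensityMatrix n) : spectrum ℝ ρ.1 ⊆ Icc (0 : ℝ) 1 := by
  rw [ρ.2.1.isHermitian.spectrum_real_eq_range_eigenvalues]
  rintro _ ⟨i, rfl⟩
  exact ρ.eigenvalues_mem_Icc i

open scoped Matrix.Norms.L2Operator in
theorem DensityMatrix.continuous_cfc {n : Type*} [Fintype n] [DecidableEq n] {g : ℝ → ℝ}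
    (hg : ContinuousOn g (Icc 0 1)) : Continuous fun ρ : DensityMatrix n => cfc g ρ.1 :=
  Continuous.cfc' isCompact_Icc g continuous_subtype_val
    DensityMatrix.spectrum_subset_Icc hg fun ρ => ρ.2.1.isHermitian

theorem continuous_bregmanDiv {n : Type*} [Fintype n] [DecidableEq n] {f : ℝ → ℝ}
    (hf : ContDiffOn ℝ 1 f (Icc 0 1)) :
    Continuous fun q : DensityMatrix n × DensityMatrix n => bregmanDiv f q.1 q.2 := by
  have h1 := DensityMatrix.continuous_cfc (n := n) hf.continuousOn
  have h2 := DensityMatrix.continuous_cfc (n := n)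
    (hf.continuousOn_derivWithin (uniqueDiffOn_Icc one_pos) le_rfl)
  have h3 : Continuous fun ρ : DensityMatrix n => ρ.1 := continuous_subtype_val
  unfold bregmanDiv
  refine Complex.continuous_re.comp (Continuous.matrix_trace ?_)
  exact ((h1.comp continuous_fst).sub (h1.comp continuous_snd)).sub
    ((h2.comp continuous_snd).mul ((h3.comp continuous_fst).sub (h3.comp continuous_snd)))

/-! ### Klein's inequality -/

/-- The trace of a product of functions of two Hermitian matrices, by the squared overlaps of their
eigenvectors. -/
theorem Matrix.IsHermitian.trace_cfc_mul_cfc {n : Type*} [Fintype n] [DecidableEq n]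
    {A B : Matrix n n ℂ} (hA : A.IsHermitian) (hB : B.IsHermitian) (g h : ℝ → ℝ) :
    (cfc g A * cfc h B).trace = ((∑ i, ∑ j, g (hA.eigenvalues i) * h (hB.eigenvalues j) *
      ‖(star (hA.eigenvectorUnitary : Matrix n n ℂ) *
        (hB.eigenvectorUnitary : Matrix n n ℂ)) i j‖ ^ 2 : ℝ) : ℂ) := by
  rw [hA.cfc_eq, hB.cfc_eq, Matrix.IsHermitian.cfc, Matrix.IsHermitian.cfc,
    Unitary.conjStarAlgAut_apply, Unitary.conjStarAlgAut_apply]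
  set U : Matrix n n ℂ := (hA.eigenvectorUnitary : Matrix n n ℂ)
  set V : Matrix n n ℂ := (hB.eigenvectorUnitary : Matrix n n ℂ)
  set W := star U * V with hW
  have hW' : star V * U = star W := by rw [hW, star_mul, star_star]
  set D : Matrix n n ℂ := Matrix.diagonal (RCLike.ofReal ∘ g ∘ hA.eigenvalues)
  set E : Matrix n n ℂ := Matrix.diagonal (RCLike.ofReal ∘ h ∘ hB.eigenvalues)
  have : (U * D * star U * (V * E * star V)).trace = (D * W * E * star W).trace := by
    rw [← hW', hW, Matrix.mul_assoc U D, Matrix.mul_assoc U (D * star U),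
      Matrix.trace_mul_comm U]
    simp only [Matrix.mul_assoc]
  rw [this]
  simp only [Matrix.trace, Matrix.diag, Matrix.mul_apply (N := star W), D, E,
    Matrix.mul_diagonal, Matrix.diagonal_mul, Matrix.star_apply]
  push_cast
  refine Finset.sum_congr rfl fun i _ => Finset.sum_congr rfl fun j _ => ?_
  rw [← Complex.mul_conj']
  simp only [Function.comp, RCLike.star_def]
  simp
  ring

/-- The tangent line inequality, with one-sided derivatives at boundary points of `s`. -/
theorem ConvexOn.le_sub_derivWithin_mul {f : ℝ → ℝ} {s : Set ℝ} (hf : ConvexOn ℝ s f)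
    (hd : DifferentiableOn ℝ f s) {x y : ℝ} (hx : x ∈ s) (hy : y ∈ s) :
    0 ≤ f y - f x - derivWithin f s x * (y - x) := by
  rcases lt_trichotomy x y with h | rfl | h
  · have := hf.derivWithin_le_slope hx hy h (hd x hx)
    rw [slope_def_field, le_div_iff₀ (sub_pos.mpr h)] at this
    linarith
  · simp
  · have := hf.slope_le_derivWithin hy hx h (hd x hx)
    rw [slope_def_field, div_le_iff₀ (sub_pos.mpr h)] at this
    linarith

theorem bregmanDiv_eq {n : Type*} [Fintype n] [DecidableEq n] (f : ℝ → ℝ)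
    (ρ σ : DensityMatrix n) : bregmanDiv f ρ σ = (cfc f ρ.1).trace.re - (cfc f σ.1).trace.re -
      ((cfc (derivWithin f (Icc 0 1)) σ.1 * ρ.1).trace.re -
        (cfc (derivWithin f (Icc 0 1)) σ.1 * σ.1).trace.re) := by
  simp [bregmanDiv, Matrix.mul_sub]

theorem bregmanDiv_self {n : Type*} [Fintype n] [DecidableEq n] (f : ℝ → ℝ)
    (ρ : DensityMatrix n) : bregmanDiv f ρ ρ = 0 := by
  simp [bregmanDiv]

/-- Klein's inequality: in eigenbases of `ρ` and `σ` the divergence is a sum of scalar Bregman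
divergences of eigenvalues, weighted by the squared overlaps of the eigenvectors. -/
theorem bregmanDiv_nonneg {n : Type*} [Fintype n] [DecidableEq n] {f : ℝ → ℝ}
    (hf : ConvexOn ℝ (Icc 0 1) f) (hd : DifferentiableOn ℝ f (Icc 0 1))
    (ρ σ : DensityMatrix n) : 0 ≤ bregmanDiv f ρ σ := by
  have hρ := ρ.2.1.isHermitian
  have hσ := σ.2.1.isHermitian
  have hc : ∀ (g : ℝ → ℝ) (A : DensityMatrix n), ContinuousOn g (spectrum ℝ A.1) := fun g A =>
    (Matrix.finite_real_spectrum (A := A.1)).continuousOn g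
  set f' := derivWithin f (Icc 0 1)
  have h1 : ∀ A : DensityMatrix n, cfc (fun _ : ℝ => (1 : ℝ)) A.1 = 1 := fun A =>
    cfc_const_one ℝ A.1 (A.2.1.isHermitian : IsSelfAdjoint A.1)
  have hid : ∀ A : DensityMatrix n, cfc (fun x : ℝ => x) A.1 = A.1 := fun A =>
    cfc_id' ℝ A.1 (A.2.1.isHermitian : IsSelfAdjoint A.1)
  have e1 := hσ.trace_cfc_mul_cfc hρ (fun _ => 1) f
  have e2 := hσ.trace_cfc_mul_cfc hρ f (fun _ => 1)
  have e3 := hσ.trace_cfc_mul_cfc hρ f' (fun x => x)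
  have e4 := hσ.trace_cfc_mul_cfc hρ (fun x => f' x * x) (fun _ => 1)
  rw [h1, one_mul] at e1
  rw [h1, mul_one] at e2
  rw [hid] at e3
  rw [h1, mul_one, cfc_mul f' (fun x => x) σ.1 (hc _ _) (hc _ _), hid] at e4
  rw [bregmanDiv_eq, e1, e2, e3, e4]
  simp only [Complex.ofReal_re, ← Finset.sum_sub_distrib]
  refine Finset.sum_nonneg fun i _ => Finset.sum_nonneg fun j _ => ?_
  rw [← sub_mul, ← sub_mul, ← sub_mul]
  refine mul_nonneg ?_ (sq_nonneg _)
  have := hf.le_sub_derivWithin_mul hd (σ.eigenvalues_mem_Icc i) (ρ.eigenvalues_mem_Icc j)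
  change 0 ≤ _ - _ - f' _ * _ at this
  linarith

/-! ### Subsequences of linear maps that converge projectively at every vector -/

/-- The rescaling `c` depends on the vector `v`. Normalize the maps in operator norm and extract a
nonzero limit `B`; vectors outside the kernel of `B` are settled, and on the kernel, which has
smaller dimension, the same is repeated. -/
theorem exists_subseq_forall_tendsto_smul {F : Type*} [NormedAddCommGroup F] [NormedSpace ℂ F]
    [FiniteDimensional ℂ F] (d : ℕ) : ∀ (E : Type*) [NormedAddCommGroup E] [NormedSpace ℂ E]
    [FiniteDimensional ℂ E], Module.finrank ℂ E = d → ∀ L : ℕ → E →L[ℂ] F,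
    ∃ φ : ℕ → ℕ, StrictMono φ ∧ ∀ v, (∀ k, L (φ k) v = 0) ∨
      ∃ c : ℕ → ℝ, (∀ k, 0 < c k) ∧ ∃ y, y ≠ 0 ∧
        Tendsto (fun k => (c k : ℂ) • L (φ k) v) atTop (𝓝 y) := by
  induction d using Nat.strong_induction_on with
  | _ d ih =>
  intro E _ _ _ hd L
  by_cases h0 : ∃ᶠ k in atTop, L k = 0
  · obtain ⟨φ, hφ, h⟩ := extraction_of_frequently_atTop h0
    exact ⟨φ, hφ, fun v => Or.inl fun k => by rw [h k]; rfl⟩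
  rw [not_frequently] at h0
  obtain ⟨φ₀, hφ₀, hne⟩ := extraction_of_eventually_atTop h0
  have hpos : ∀ k, 0 < ‖L (φ₀ k)‖ := fun k => norm_pos_iff.mpr (hne k)
  have : ProperSpace (E →L[ℂ] F) := FiniteDimensional.proper ℂ _
  obtain ⟨B, hB, φ₁, hφ₁, hlim⟩ := (isCompact_sphere (0 : E →L[ℂ] F) 1).tendsto_subseq
    (x := fun k => ((‖L (φ₀ k)‖⁻¹ : ℝ) : ℂ) • L (φ₀ k)) (fun k => by
      rw [mem_sphere_zero_iff_norm, norm_smul, Complex.norm_real, norm_inv, norm_norm,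
        inv_mul_cancel₀ (hpos k).ne'])
  have hB0 : B ≠ 0 := by
    rintro rfl
    simp at hB
  have hlt : Module.finrank ℂ (LinearMap.ker (B : E →ₗ[ℂ] F)) < d := by
    rw [← hd]
    refine Submodule.finrank_lt fun htop => hB0 ?_
    ext v
    exact (htop ▸ Submodule.mem_top : v ∈ LinearMap.ker (B : E →ₗ[ℂ] F))
  obtain ⟨φ₂, hφ₂, h₂⟩ := ih _ hlt (LinearMap.ker (B : E →ₗ[ℂ] F)) rfl
    fun k => (L (φ₀ (φ₁ k))).comp (Submodule.subtypeL _)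
  refine ⟨φ₀ ∘ φ₁ ∘ φ₂, hφ₀.comp (hφ₁.comp hφ₂), fun v => ?_⟩
  by_cases hv : B v = 0
  · exact h₂ ⟨v, hv⟩
  · refine Or.inr ⟨fun k => ‖L (φ₀ (φ₁ (φ₂ k)))‖⁻¹, fun k => inv_pos.mpr (hpos _), B v, hv, ?_⟩
    have h := (hlim.comp hφ₂.tendsto_atTop)
    exact ((ContinuousLinearMap.apply ℂ F v).continuous.tendsto B).comp h

/-! ### Normalization of positive semidefinite matrices -/

open Classical in
/-- The density matrix `A / Tr A` for a nonzero positive semidefinite matrix `A`, and the fixed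
state `ρ₀` for every other matrix. -/
noncomputable def normalizedState {n : Type*} [Fintype n] (ρ₀ : DensityMatrix n)
    (A : Matrix n n ℂ) : DensityMatrix n :=
  if h : A.PosSemidef ∧ A ≠ 0 then
    ⟨A.trace⁻¹ • A, h.1.smul (inv_nonneg.mpr h.1.trace_nonneg), by
      rw [Matrix.trace_smul, smul_eq_mul, inv_mul_cancel₀ (h.1.trace_eq_zero_iff.not.mpr h.2)]⟩
  else ρ₀

section normalizedState

variable {n : Type*} [Fintype n] (ρ₀ : DensityMatrix n)

@[simp]
theorem normalizedState_zero : normalizedState ρ₀ 0 = ρ₀ := by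
  simp [normalizedState]

theorem coe_normalizedState {A : Matrix n n ℂ} (hA : A.PosSemidef) (h0 : A ≠ 0) :
    (normalizedState ρ₀ A).1 = A.trace⁻¹ • A := by
  simp [normalizedState, hA, h0]

theorem trace_smul_normalizedState {A : Matrix n n ℂ} (hA : A.PosSemidef) :
    A.trace • (normalizedState ρ₀ A).1 = A := by
  rcases eq_or_ne A 0 with rfl | h0
  · simp
  · rw [coe_normalizedState ρ₀ hA h0, smul_inv_smul₀ (hA.trace_eq_zero_iff.not.mpr h0)]

theorem normalizedState_smul {A : Matrix n n ℂ} (hA : A.PosSemidef) {c : ℝ} (hc : 0 < c) :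
    normalizedState ρ₀ ((c : ℂ) • A) = normalizedState ρ₀ A := by
  rcases eq_or_ne A 0 with rfl | h0
  · simp
  have hc' : (c : ℂ) ≠ 0 := by exact_mod_cast hc.ne'
  have hcA : ((c : ℂ) • A).PosSemidef := hA.smul (by exact_mod_cast hc.le)
  apply Subtype.ext
  rw [coe_normalizedState ρ₀ hA h0, coe_normalizedState ρ₀ hcA (smul_ne_zero hc' h0),
    Matrix.trace_smul, smul_smul, smul_eq_mul, mul_inv, mul_assoc, mul_comm _ (c : ℂ), ← mul_assoc,
    inv_mul_cancel₀ hc', one_mul]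

theorem tendsto_normalizedState {ι : Type*} {l : Filter ι} [l.NeBot] {A : ι → Matrix n n ℂ}
    {B : Matrix n n ℂ} (hA : ∀ k, (A k).PosSemidef) (hB : B ≠ 0) (h : Tendsto A l (𝓝 B)) :
    Tendsto (fun k => normalizedState ρ₀ (A k)) l (𝓝 (normalizedState ρ₀ B)) := by
  have hBp : B.PosSemidef :=
    isClosed_setOf_posSemidef.mem_of_tendsto h (Eventually.of_forall hA)
  have htr : Tendsto (fun k => (A k).trace) l (𝓝 B.trace) :=
    ((Continuous.matrix_trace continuous_id).tendsto B).comp h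
  rw [tendsto_subtype_rng, coe_normalizedState ρ₀ hBp hB]
  refine Tendsto.congr' ?_ ((htr.inv₀ (hBp.trace_eq_zero_iff.not.mpr hB)).smul h)
  filter_upwards [h.eventually_ne hB] with k hk
  rw [coe_normalizedState ρ₀ (hA k) hk]

theorem measurable_normalizedState_apply {X : Type*} [MeasurableSpace X] {A : X → Matrix n n ℂ}
    (hA : ∀ i j, Measurable fun x => A x i j) (hpos : ∀ x, (A x).PosSemidef) :
    IsEstimator fun x => normalizedState ρ₀ (A x) := by
  classical
  intro i j
  have htr : Measurable fun x => (A x).trace := by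
    simp only [Matrix.trace, Matrix.diag]
    exact Finset.measurable_sum _ fun i _ => hA i i
  have h : (fun x => (normalizedState ρ₀ (A x)).1 i j) =
      fun x => if (A x).trace = 0 then ρ₀.1 i j else (A x).trace⁻¹ * A x i j := by
    funext x
    split_ifs with h0
    · rw [(hpos x).trace_eq_zero_iff.mp h0, normalizedState_zero]
    · rw [coe_normalizedState ρ₀ (hpos x) ((hpos x).trace_eq_zero_iff.not.mp h0)]
      rfl
  rw [h]
  exact Measurable.ite (htr (measurableSet_singleton 0)) measurable_const (htr.inv.mul (hA i j))

end normalizedState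

/-! ### The unnormalized posterior mean -/

/-- The linear map `A ↦ ∫ Tr(A ρ_θ) ρ_θ dπ(θ)`, written through the second moments of the entries
of `ρ_θ`. At `A = M(x)` its value is `p_π(x)` times the posterior mean of `ρ_θ`. -/
noncomputable def posteriorMap {n Θ : Type*} [Fintype n] [MeasurableSpace Θ]
    (ρ : Θ → DensityMatrix n) (π : ProbabilityMeasure Θ) : Matrix n n ℂ →ₗ[ℂ] Matrix n n ℂ where
  toFun A := Matrix.of fun i j =>
    ∑ k, ∑ l, A k l * ∫ θ, (ρ θ).1 l k * (ρ θ).1 i j ∂(π : Measure Θ)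
  map_add' A B := by
    ext i j
    simp [add_mul, Finset.sum_add_distrib]
  map_smul' c A := by
    ext i j
    simp [mul_assoc, Finset.mul_sum]

section posteriorMap

variable {n Θ : Type*} [Fintype n] [MetricSpace Θ] {ρ : Θ → DensityMatrix n}

theorem continuous_densityMatrix_apply (hρ : Continuous ρ) (i j : n) :
    Continuous fun θ => (ρ θ).1 i j := by
  exact (continuous_subtype_val.comp hρ).matrix_elem i j

theorem continuous_trace_mul (hρ : Continuous ρ) (A : Matrix n n ℂ) :
    Continuous fun θ => (A * (ρ θ).1).trace := by
  have : Continuous fun θ => (ρ θ).1 := continuous_subtype_val.comp hρ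
  fun_prop

variable [CompactSpace Θ] [MeasurableSpace Θ] [BorelSpace Θ]

theorem Continuous.integrable_probabilityMeasure {E : Type*} [NormedAddCommGroup E] {g : Θ → E}
    (hg : Continuous g) (π : ProbabilityMeasure Θ) : Integrable g (π : Measure Θ) :=
  hg.integrable_of_hasCompactSupport (HasCompactSupport.of_compactSpace g)

theorem posteriorMap_apply (hρ : Continuous ρ) (π : ProbabilityMeasure Θ) (A : Matrix n n ℂ)
    (i j : n) : posteriorMap ρ π A i j =
      ∫ θ, (A * (ρ θ).1).trace * (ρ θ).1 i j ∂(π : Measure Θ) := by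
  have hint : ∀ k l, Integrable (fun θ => A k l * ((ρ θ).1 l k * (ρ θ).1 i j))
      (π : Measure Θ) := fun k l =>
    (continuous_const.mul ((continuous_densityMatrix_apply hρ l k).mul
      (continuous_densityMatrix_apply hρ i j))).integrable_probabilityMeasure π
  calc posteriorMap ρ π A i j
      = ∑ k, ∑ l, A k l * ∫ θ, (ρ θ).1 l k * (ρ θ).1 i j ∂(π : Measure Θ) := rfl
    _ = ∫ θ, ∑ k, ∑ l, A k l * ((ρ θ).1 l k * (ρ θ).1 i j) ∂(π : Measure Θ) := by
        rw [integral_finsetSum _ fun k _ => integrable_finsetSum _ fun l _ => hint k l]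
        refine Finset.sum_congr rfl fun k _ => ?_
        rw [integral_finsetSum _ fun l _ => hint k l]
        exact Finset.sum_congr rfl fun l _ => (integral_const_mul _ _).symm
    _ = _ := by
        refine integral_congr_ae (Eventually.of_forall fun θ => ?_)
        simp only [Matrix.trace, Matrix.diag, Matrix.mul_apply, Finset.sum_mul, mul_assoc]

theorem trace_mul_posteriorMap (hρ : Continuous ρ) (π : ProbabilityMeasure Θ)
    (A B : Matrix n n ℂ) : (B * posteriorMap ρ π A).trace =
      ∫ θ, (A * (ρ θ).1).trace * (B * (ρ θ).1).trace ∂(π : Measure Θ) := by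
  have hint : ∀ i j, Integrable (fun θ => B i j * ((A * (ρ θ).1).trace * (ρ θ).1 j i))
      (π : Measure Θ) := fun i j =>
    (continuous_const.mul ((continuous_trace_mul hρ A).mul
      (continuous_densityMatrix_apply hρ j i))).integrable_probabilityMeasure π
  calc (B * posteriorMap ρ π A).trace
      = ∑ i, ∑ j, B i j * ∫ θ, (A * (ρ θ).1).trace * (ρ θ).1 j i ∂(π : Measure Θ) := by
        simp only [Matrix.trace, Matrix.diag, Matrix.mul_apply (M := B), posteriorMap_apply hρ]
    _ = ∫ θ, ∑ i, ∑ j, B i j * ((A * (ρ θ).1).trace * (ρ θ).1 j i) ∂(π : Measure Θ) := by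
        rw [integral_finsetSum _ fun k _ => integrable_finsetSum _ fun l _ => hint k l]
        refine Finset.sum_congr rfl fun k _ => ?_
        rw [integral_finsetSum _ fun l _ => hint k l]
        exact Finset.sum_congr rfl fun l _ => (integral_const_mul _ _).symm
    _ = _ := by
        refine integral_congr_ae (Eventually.of_forall fun θ => ?_)
        simp only [Matrix.trace, Matrix.diag, Matrix.mul_apply (M := B), Finset.mul_sum]
        refine Finset.sum_congr rfl fun i _ => Finset.sum_congr rfl fun j _ => by ring

theorem trace_posteriorMap [DecidableEq n] (hρ : Continuous ρ) (π : ProbabilityMeasure Θ)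
    (A : Matrix n n ℂ) :
    (posteriorMap ρ π A).trace = ∫ θ, (A * (ρ θ).1).trace ∂(π : Measure Θ) := by
  have h := trace_mul_posteriorMap hρ π A 1
  simpa only [one_mul, (ρ _).2.2, mul_one] using h

theorem posSemidef_posteriorMap [DecidableEq n] (hρ : Continuous ρ) (π : ProbabilityMeasure Θ)
    {A : Matrix n n ℂ} (hA : A.PosSemidef) : (posteriorMap ρ π A).PosSemidef := by
  -- The quadratic form of a matrix `T` at `v` is `Tr (v v* T)`.
  have hquad : ∀ (v : n → ℂ) (T : Matrix n n ℂ),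
      star v ⬝ᵥ (T *ᵥ v) = (Matrix.vecMulVec v (star v) * T).trace := fun v T => by
    rw [Matrix.vecMulVec_mul, Matrix.trace_vecMulVec, dotProduct_comm v,
      Matrix.dotProduct_mulVec]
  have hnn : ∀ v : n → ℂ, 0 ≤ star v ⬝ᵥ (posteriorMap ρ π A *ᵥ v) := by
    intro v
    rw [hquad, trace_mul_posteriorMap hρ]
    refine integral_nonneg fun θ => mul_nonneg (hA.trace_mul_nonneg (ρ θ).2.1) ?_
    exact (Matrix.posSemidef_vecMulVec_self_star v).trace_mul_nonneg (ρ θ).2.1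
  exact Matrix.posSemidef_of_forall_dotProduct_mulVec_nonneg hnn

theorem tendsto_posteriorMap (hρ : Continuous ρ) {ι : Type*} {l : Filter ι}
    {π : ι → ProbabilityMeasure Θ} {π₀ : ProbabilityMeasure Θ} (h : Tendsto π l (𝓝 π₀))
    (A : Matrix n n ℂ) :
    Tendsto (fun k => posteriorMap ρ (π k) A) l (𝓝 (posteriorMap ρ π₀ A)) := by
  refine tendsto_pi_nhds.mpr fun i => tendsto_pi_nhds.mpr fun j => ?_
  refine tendsto_finsetSum _ fun k _ => tendsto_finsetSum _ fun m _ => Tendsto.const_mul _ ?_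
  exact (ProbabilityMeasure.tendsto_iff_forall_integral_rclike_tendsto ℂ).mp h
    (BoundedContinuousFunction.mkOfCompact ⟨fun θ => (ρ θ).1 m k * (ρ θ).1 i j,
      (continuous_densityMatrix_apply hρ m k).mul (continuous_densityMatrix_apply hρ i j)⟩)

end posteriorMap

/-! ### Likelihoods and Bayes estimators -/

/-- The Bayes estimator for the prior `π` that takes the value `ρ₀` where `p_π(x) = 0`. -/
noncomputable def bayesEstimator {X n Θ : Type*} [Fintype n] [MeasurableSpace Θ]
    (M : X → Matrix n n ℂ) (ρ : Θ → DensityMatrix n) (ρ₀ : DensityMatrix n)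
    (π : ProbabilityMeasure Θ) (x : X) : DensityMatrix n :=
  normalizedState ρ₀ (posteriorMap ρ π (M x))

section likelihood

variable {X n Θ : Type*} [Fintype n] {M : X → Matrix n n ℂ}
  {ρ : Θ → DensityMatrix n}

theorem continuous_likelihood [MetricSpace Θ] (hρ : Continuous ρ) (x : X) :
    Continuous fun θ => likelihood M ρ x θ :=
  Complex.continuous_re.comp (continuous_trace_mul hρ (M x))

variable [DecidableEq n]

theorem coe_likelihood (hM : ∀ x, (M x).PosSemidef) (x : X) (θ : Θ) :
    (likelihood M ρ x θ : ℂ) = (M x * (ρ θ).1).trace :=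
  (Complex.eq_re_of_ofReal_le (r := 0) (by simpa using (hM x).trace_mul_nonneg (ρ θ).2.1)).symm

theorem likelihood_nonneg (hM : ∀ x, (M x).PosSemidef) (x : X) (θ : Θ) :
    0 ≤ likelihood M ρ x θ :=
  trace_mul_re_nonneg (hM x) (ρ θ).2.1

theorem likelihood_le (hM : ∀ x, (M x).PosSemidef)
    (htr : ∀ x, (M x).trace = (Fintype.card n : ℂ)) (x : X) (θ : Θ) :
    likelihood M ρ x θ ≤ Fintype.card n ^ 3 := by
  calc likelihood M ρ x θ ≤ ‖(M x * (ρ θ).1).trace‖ := Complex.re_le_norm _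
    _ ≤ ∑ i, ∑ j, ‖M x i j * (ρ θ).1 j i‖ := by
        simp only [Matrix.trace, Matrix.diag, Matrix.mul_apply]
        exact (norm_sum_le _ _).trans (Finset.sum_le_sum fun i _ => norm_sum_le _ _)
    _ ≤ ∑ _i : n, ∑ _j : n, (Fintype.card n : ℝ) := by
        refine Finset.sum_le_sum fun i _ => Finset.sum_le_sum fun j _ => ?_
        have h1 := (hM x).norm_apply_le_trace i j
        have h2 := (ρ θ).2.1.norm_apply_le_trace j i
        rw [htr, Complex.natCast_re] at h1
        rw [(ρ θ).2.2, Complex.one_re] at h2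
        rw [norm_mul]
        calc _ ≤ (Fintype.card n : ℝ) * 1 := by gcongr
          _ = _ := mul_one _
    _ = Fintype.card n ^ 3 := by simp; ring

variable [MetricSpace Θ] [CompactSpace Θ] [MeasurableSpace Θ] [BorelSpace Θ]

theorem coe_marginal (hM : ∀ x, (M x).PosSemidef) (hρ : Continuous ρ)
    (π : ProbabilityMeasure Θ) (x : X) :
    (marginal M ρ π x : ℂ) = (posteriorMap ρ π (M x)).trace := by
  rw [trace_posteriorMap hρ, marginal, ← integral_complex_ofReal]
  simp only [coe_likelihood hM]

theorem posteriorMap_eq_zero_iff (hM : ∀ x, (M x).PosSemidef) (hρ : Continuous ρ)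
    (π : ProbabilityMeasure Θ) (x : X) :
    posteriorMap ρ π (M x) = 0 ↔ marginal M ρ π x = 0 := by
  rw [← (posSemidef_posteriorMap hρ π (hM x)).trace_eq_zero_iff, ← coe_marginal hM hρ,
    Complex.ofReal_eq_zero]

variable [MeasurableSpace X]

theorem isBayesEstimator_bayesEstimator (hM : ∀ x, (M x).PosSemidef)
    (hmeas : ∀ i j, Measurable fun x => M x i j) (hρ : Continuous ρ) (ρ₀ : DensityMatrix n)
    (π : ProbabilityMeasure Θ) : IsBayesEstimator M ρ π (bayesEstimator M ρ ρ₀ π) := by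
  have hpos : ∀ x, (posteriorMap ρ π (M x)).PosSemidef := fun x =>
    posSemidef_posteriorMap hρ π (hM x)
  refine ⟨measurable_normalizedState_apply ρ₀ (fun i j => ?_) hpos, fun x hx i j => ?_⟩
  · exact Finset.measurable_sum _ fun k _ => Finset.measurable_sum _ fun l _ =>
      (hmeas k l).mul_const _
  · rw [bayesEstimator, coe_normalizedState ρ₀ (hpos x)
      ((posteriorMap_eq_zero_iff hM hρ π x).not.mpr hx.ne'), ← coe_marginal hM hρ,
      Matrix.smul_apply, posteriorMap_apply hρ, smul_eq_mul, ← integral_const_mul]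
    refine integral_congr_ae (Eventually.of_forall fun θ => ?_)
    simp only
    rw [← coe_likelihood hM, Complex.ofReal_div]
    ring

end likelihood

/-! ### The measurable structure of the state space -/

section measurableSpace

variable {n : Type*} [Fintype n]

/-- The Borel σ-algebra of the topology of matrices. -/
noncomputable instance DensityMatrix.instMeasurableSpace : MeasurableSpace (DensityMatrix n) :=
  borel _

instance DensityMatrix.instBorelSpace : BorelSpace (DensityMatrix n) := ⟨rfl⟩

instance DensityMatrix.instSecondCountableTopology :
    SecondCountableTopology (DensityMatrix n) :=
  have : SecondCountableTopology (Matrix n n ℂ) :=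
    inferInstanceAs (SecondCountableTopology (n → n → ℂ))
  TopologicalSpace.Subtype.secondCountableTopology _

/-- Entrywise measurability is Borel measurability. -/
theorem isEstimator_iff_measurable {X : Type*} [MeasurableSpace X] {σ : X → DensityMatrix n} :
    IsEstimator σ ↔ Measurable σ := by
  have hcl : IsClosedEmbedding fun (A : DensityMatrix n) (i j : n) => A.1 i j :=
    isClosed_setOf_densityMatrix.isClosedEmbedding_subtypeVal
  rw [← hcl.measurableEmbedding.measurable_comp_iff]
  simp only [IsEstimator, measurable_pi_iff]
  rfl

theorem isEstimator_of_tendsto {X : Type*} [MeasurableSpace X]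
    {τ : ℕ → X → DensityMatrix n} (hτ : ∀ k, IsEstimator (τ k))
    {τ' : X → DensityMatrix n} (h : ∀ x, Tendsto (fun k => τ k x) atTop (𝓝 (τ' x))) :
    IsEstimator τ' := by
  intro i j
  refine measurable_of_tendsto_metrizable (fun k => hτ k i j) (tendsto_pi_nhds.mpr fun x => ?_)
  exact ((continuous_subtype_val.matrix_elem i j).tendsto (τ' x)).comp (h x)

end measurableSpace

theorem Continuous.measurable_comp_prodMk {n Y E : Type*} [Fintype n] [MeasurableSpace Y]
    [TopologicalSpace E] [MeasurableSpace E] [BorelSpace E]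
    {F : DensityMatrix n × DensityMatrix n → E} (hF : Continuous F) {u v : Y → DensityMatrix n}
    (hu : Measurable u) (hv : Measurable v) : Measurable fun y => F (u y, v y) :=
  hF.measurable.comp (hu.prodMk hv)

theorem measurable_bregmanDiv {n : Type*} [Fintype n] [DecidableEq n] {f : ℝ → ℝ}
    (hf : ContDiffOn ℝ 1 f (Icc 0 1)) {Y : Type*} [MeasurableSpace Y] {u v : Y → DensityMatrix n}
    (hu : Measurable u) (hv : Measurable v) : Measurable fun y => bregmanDiv f (u y) (v y) :=
  (continuous_bregmanDiv hf).measurable_comp_prodMk hu hv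

/-! ### The risk as an integral against the density -/

section risk

variable {n : Type*} [Fintype n] [DecidableEq n] {X : Type*} [MeasurableSpace X]
  {Θ : Type*} {P : POVM X n} {ν : Measure X} {M : X → Matrix n n ℂ}
  {ρ : Θ → DensityMatrix n} {f : ℝ → ℝ}

theorem POVM.IsDensity.norm_apply_le (hM : P.IsDensity ν M) (x : X) (i j : n) :
    ‖M x i j‖ ≤ Fintype.card n := by
  have h := (hM.posSemidef x).norm_apply_le_trace i j
  rwa [hM.trace_eq, Complex.natCast_re] at h

theorem POVM.IsDensity.integrable_apply (hM : P.IsDensity ν M) (i j : n) :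
    Integrable (fun x => M x i j) ν := by
  have := hM.isProbabilityMeasure
  exact Integrable.of_bound (hM.measurable i j).aestronglyMeasurable (Fintype.card n)
    (Eventually.of_forall fun x => hM.norm_apply_le x i j)

theorem POVM.IsDensity.measurable_likelihood (hM : P.IsDensity ν M) (θ : Θ) :
    Measurable fun x => likelihood M ρ x θ := by
  simp only [likelihood, Matrix.trace, Matrix.diag, Matrix.mul_apply]
  exact Complex.measurable_re.comp (Finset.measurable_sum _ fun i _ =>
    Finset.measurable_sum _ fun j _ => (hM.measurable i j).mul_const _)

theorem POVM.IsDensity.born_eq_withDensity (hM : P.IsDensity ν M) (θ : Θ) :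
    P.born (ρ θ) = ν.withDensity fun x => ENNReal.ofReal (likelihood M ρ x θ) := by
  ext B hB
  have := hM.isProbabilityMeasure
  have hint : Integrable (fun x => likelihood M ρ x θ) (ν.restrict B) :=
    Integrable.of_bound (hM.measurable_likelihood θ).aestronglyMeasurable (Fintype.card n ^ 3)
      (Eventually.of_forall fun x => by
        rw [Real.norm_of_nonneg (likelihood_nonneg hM.posSemidef x θ)]
        exact likelihood_le hM.posSemidef hM.trace_eq x θ)
  rw [withDensity_apply _ hB, POVM.born, Measure.ofMeasurable_apply _ hB,
    ← ofReal_integral_eq_lintegral_ofReal hint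
      (Eventually.of_forall fun x => likelihood_nonneg hM.posSemidef x θ)]
  congr 1
  have hterm : ∀ i j, Integrable (fun x => M x i j * (ρ θ).1 j i) (ν.restrict B) := fun i j =>
    (hM.integrable_apply i j).restrict.mul_const _
  have h : (P.toVectorMeasure B * (ρ θ).1).trace =
      ((∫ x in B, likelihood M ρ x θ ∂ν : ℝ) : ℂ) := by
    rw [← integral_complex_ofReal]
    simp only [coe_likelihood hM.posSemidef, Matrix.trace, Matrix.diag, Matrix.mul_apply]
    rw [integral_finsetSum _ fun i _ => integrable_finsetSum _ fun j _ => hterm i j]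
    refine Finset.sum_congr rfl fun i _ => ?_
    rw [integral_finsetSum _ fun j _ => hterm i j]
    refine Finset.sum_congr rfl fun j _ => ?_
    rw [integral_mul_const, hM.apply_eq B hB]
  rw [h, Complex.ofReal_re]

theorem POVM.IsDensity.risk_eq (hM : P.IsDensity ν M) (θ : Θ) (τ : X → DensityMatrix n) :
    risk P f (ρ θ) τ = ∫ x, likelihood M ρ x θ * bregmanDiv f (ρ θ) (τ x) ∂ν := by
  rw [risk, hM.born_eq_withDensity θ, integral_withDensity_eq_integral_toReal_smul
    (hM.measurable_likelihood θ).ennreal_ofReal (Eventually.of_forall fun x => by simp)]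
  simp only [ENNReal.toReal_ofReal (likelihood_nonneg hM.posSemidef _ θ), smul_eq_mul]

theorem exists_forall_bregmanDiv_le (hf : ContDiffOn ℝ 1 f (Icc 0 1)) :
    ∃ C, 0 ≤ C ∧ ∀ ω τ : DensityMatrix n, |bregmanDiv f ω τ| ≤ C := by
  obtain ⟨C, hC⟩ := (isCompact_range (continuous_bregmanDiv (n := n) hf)).isBounded.exists_norm_le
  exact ⟨max C 0, le_max_right _ _, fun ω τ =>
    (hC _ (mem_range_self (ω, τ))).trans (le_max_left _ _)⟩

theorem POVM.IsDensity.exists_forall_norm_le (hM : P.IsDensity ν M)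
    (ρ : Θ → DensityMatrix n) (hf : ContDiffOn ℝ 1 f (Icc 0 1)) :
    ∃ C, 0 ≤ C ∧ ∀ (θ : Θ) (x : X) (ω τ : DensityMatrix n),
      ‖likelihood M ρ x θ * bregmanDiv f ω τ‖ ≤ C := by
  obtain ⟨C, hC0, hC⟩ := exists_forall_bregmanDiv_le (n := n) hf
  refine ⟨Fintype.card n ^ 3 * C, by positivity, fun θ x ω τ => ?_⟩
  rw [norm_mul, Real.norm_of_nonneg (likelihood_nonneg hM.posSemidef x θ)]
  exact mul_le_mul (likelihood_le hM.posSemidef hM.trace_eq x θ) (hC ω τ) (norm_nonneg _)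
    (by positivity)

theorem POVM.IsDensity.exists_forall_abs_risk_le (hM : P.IsDensity ν M)
    (ρ : Θ → DensityMatrix n) (hf : ContDiffOn ℝ 1 f (Icc 0 1)) :
    ∃ C, 0 ≤ C ∧ ∀ (θ : Θ) (τ : X → DensityMatrix n), ‖risk P f (ρ θ) τ‖ ≤ C := by
  obtain ⟨C, hC0, hC⟩ := hM.exists_forall_norm_le ρ hf
  have := hM.isProbabilityMeasure
  refine ⟨C, hC0, fun θ τ => ?_⟩
  rw [hM.risk_eq θ τ]
  simpa using norm_integral_le_of_norm_le_const (μ := ν)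
    (Eventually.of_forall fun x => hC θ x (ρ θ) (τ x))

theorem POVM.IsDensity.measurable_risk_integrand (hM : P.IsDensity ν M)
    (hf : ContDiffOn ℝ 1 f (Icc 0 1)) (θ : Θ) {τ : X → DensityMatrix n} (hτ : IsEstimator τ) :
    Measurable fun x => likelihood M ρ x θ * bregmanDiv f (ρ θ) (τ x) :=
  (hM.measurable_likelihood θ).mul
    (measurable_bregmanDiv hf measurable_const (isEstimator_iff_measurable.mp hτ))

theorem POVM.IsDensity.continuous_risk [MetricSpace Θ] (hM : P.IsDensity ν M) (hρ : Continuous ρ)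
    (hf : ContDiffOn ℝ 1 f (Icc 0 1)) {τ : X → DensityMatrix n} (hτ : IsEstimator τ) :
    Continuous fun θ => risk P f (ρ θ) τ := by
  obtain ⟨C, hC0, hC⟩ := hM.exists_forall_norm_le ρ hf
  have := hM.isProbabilityMeasure
  simp only [hM.risk_eq]
  refine continuous_of_dominated (bound := fun _ => C)
    (fun θ => (hM.measurable_risk_integrand hf θ hτ).aestronglyMeasurable)
    (fun θ => Eventually.of_forall fun x => hC θ x _ _) (integrable_const _)
    (Eventually.of_forall fun x => ?_)
  exact (continuous_likelihood hρ x).mul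
    ((continuous_bregmanDiv hf).comp (hρ.prodMk continuous_const))

theorem POVM.IsDensity.tendsto_risk (hM : P.IsDensity ν M) (hf : ContDiffOn ℝ 1 f (Icc 0 1))
    {τ : ℕ → X → DensityMatrix n} (hτ : ∀ k, IsEstimator (τ k)) {τ' : X → DensityMatrix n}
    (h : ∀ x, Tendsto (fun k => τ k x) atTop (𝓝 (τ' x))) (θ : Θ) :
    Tendsto (fun k => risk P f (ρ θ) (τ k)) atTop (𝓝 (risk P f (ρ θ) τ')) := by
  obtain ⟨C, hC0, hC⟩ := hM.exists_forall_norm_le ρ hf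
  have := hM.isProbabilityMeasure
  simp only [hM.risk_eq]
  refine tendsto_integral_of_dominated_convergence (fun _ => C)
    (fun k => (hM.measurable_risk_integrand hf θ (hτ k)).aestronglyMeasurable)
    (integrable_const _) (fun k => Eventually.of_forall fun x => hC θ x _ _)
    (Eventually.of_forall fun x => ?_)
  exact ((((continuous_bregmanDiv hf).comp (continuous_const.prodMk continuous_id)).tendsto
    (τ' x)).comp (h x)).const_mul _

end risk

/-! ### Bayes estimators minimize the Bayes risk -/

section bayes

variable {n : Type*} [Fintype n] [DecidableEq n] {X : Type*}
  {Θ : Type*} [MetricSpace Θ] [CompactSpace Θ] [MeasurableSpace Θ] [BorelSpace Θ]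
  {M : X → Matrix n n ℂ} {ρ : Θ → DensityMatrix n} {f : ℝ → ℝ}

/-- The posterior expected loss at a single outcome is minimal at the posterior mean: the loss
difference `D_f(ρ, τ) - D_f(ρ, τ')` is affine in `ρ`, so averaging it amounts to evaluating it at
the posterior mean. -/
theorem integral_likelihood_mul_bregmanDiv_sub_nonneg (hM : ∀ x, (M x).PosSemidef)
    (hρ : Continuous ρ) (hf : ConvexOn ℝ (Icc 0 1) f) (hd : DifferentiableOn ℝ f (Icc 0 1))
    (ρ₀ : DensityMatrix n) (π : ProbabilityMeasure Θ) (x : X) (τ : DensityMatrix n) :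
    0 ≤ ∫ θ, likelihood M ρ x θ * (bregmanDiv f (ρ θ) τ -
      bregmanDiv f (ρ θ) (bayesEstimator M ρ ρ₀ π x)) ∂(π : Measure Θ) := by
  set S := bayesEstimator M ρ ρ₀ π x with hS
  obtain ⟨c, B, hcB⟩ : ∃ (c : ℝ) (B : Matrix n n ℂ), ∀ ω : DensityMatrix n,
      bregmanDiv f ω τ - bregmanDiv f ω S = c - (B * ω.1).trace.re := by
    refine ⟨(cfc f S.1).trace.re - (cfc f τ.1).trace.re +
      (cfc (derivWithin f (Icc 0 1)) τ.1 * τ.1).trace.re -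
      (cfc (derivWithin f (Icc 0 1)) S.1 * S.1).trace.re,
      cfc (derivWithin f (Icc 0 1)) τ.1 - cfc (derivWithin f (Icc 0 1)) S.1, fun ω => ?_⟩
    rw [bregmanDiv_eq, bregmanDiv_eq, Matrix.sub_mul, Matrix.trace_sub, Complex.sub_re]
    ring
  have hpost : (posteriorMap ρ π (M x)).trace • S.1 = posteriorMap ρ π (M x) :=
    trace_smul_normalizedState ρ₀ (posSemidef_posteriorMap hρ π (hM x))
  have h1 : ∫ θ, likelihood M ρ x θ * (B * (ρ θ).1).trace.re ∂(π : Measure Θ) =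
      marginal M ρ π x * (B * S.1).trace.re := by
    have h := trace_mul_posteriorMap hρ π (M x) B
    rw [← hpost, ← coe_marginal hM hρ, Matrix.mul_smul, Matrix.trace_smul, smul_eq_mul] at h
    have h' := congrArg Complex.re h
    rw [Complex.re_ofReal_mul, ← RCLike.re_eq_complex_re, ← integral_re] at h'
    · rw [RCLike.re_eq_complex_re] at h'
      rw [h']
      refine integral_congr_ae (Eventually.of_forall fun θ => ?_)
      simp only
      rw [← coe_likelihood hM, Complex.re_ofReal_mul]
    · exact ((continuous_trace_mul hρ _).mul
        (continuous_trace_mul hρ _)).integrable_probabilityMeasure π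
  have hlik := continuous_likelihood (M := M) hρ x
  have hB : Continuous fun θ => (B * (ρ θ).1).trace.re :=
    Complex.continuous_re.comp (continuous_trace_mul hρ B)
  have h2 : ∫ θ, likelihood M ρ x θ * (bregmanDiv f (ρ θ) τ - bregmanDiv f (ρ θ) S)
      ∂(π : Measure Θ) = marginal M ρ π x * (bregmanDiv f S τ) := by
    have e := hcB S
    rw [bregmanDiv_self, sub_zero] at e
    simp only [hcB, mul_sub]
    have i1 : Integrable (fun θ => likelihood M ρ x θ * c) (π : Measure Θ) :=
      (hlik.mul continuous_const).integrable_probabilityMeasure π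
    have i2 : Integrable (fun θ => likelihood M ρ x θ * (B * (ρ θ).1).trace.re)
        (π : Measure Θ) := (hlik.mul hB).integrable_probabilityMeasure π
    rw [integral_sub i1 i2, h1, integral_mul_const, e, mul_sub]
    rfl
  rw [h2]
  exact mul_nonneg (integral_nonneg fun θ => likelihood_nonneg hM x θ)
    (bregmanDiv_nonneg hf hd S τ)

variable [MeasurableSpace X] {P : POVM X n} {ν : Measure X}

theorem POVM.IsDensity.integral_risk_bayesEstimator_le (hM : P.IsDensity ν M) (hρ : Continuous ρ)
    (hf : ConvexOn ℝ (Icc 0 1) f) (hf1 : ContDiffOn ℝ 1 f (Icc 0 1)) (ρ₀ : DensityMatrix n)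
    (π : ProbabilityMeasure Θ) {τ : X → DensityMatrix n} (hτ : IsEstimator τ) :
    ∫ θ, risk P f (ρ θ) (bayesEstimator M ρ ρ₀ π) ∂(π : Measure Θ) ≤
      ∫ θ, risk P f (ρ θ) τ ∂(π : Measure Θ) := by
  have := hM.isProbabilityMeasure
  obtain ⟨C, hC0, hC⟩ := hM.exists_forall_norm_le ρ hf1
  set S := bayesEstimator M ρ ρ₀ π
  have hS : IsEstimator S :=
    (isBayesEstimator_bayesEstimator hM.posSemidef hM.measurable hρ ρ₀ π).1
  have hmeas : ∀ {κ : X → DensityMatrix n}, IsEstimator κ → Measurable fun q : Θ × X =>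
      likelihood M ρ q.2 q.1 * bregmanDiv f (ρ q.1) (κ q.2) := fun {κ} hκ => by
    refine Measurable.mul ?_ (measurable_bregmanDiv hf1 (hρ.measurable.comp measurable_fst)
      ((isEstimator_iff_measurable.mp hκ).comp measurable_snd))
    simp only [likelihood, Matrix.trace, Matrix.diag, Matrix.mul_apply]
    exact Complex.measurable_re.comp (Finset.measurable_sum _ fun i _ =>
      Finset.measurable_sum _ fun j _ => ((hM.measurable i j).comp measurable_snd).mul
        ((continuous_densityMatrix_apply hρ j i).measurable.comp measurable_fst))
  have hint : ∀ {κ : X → DensityMatrix n}, IsEstimator κ → Integrable (fun q : Θ × X =>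
      likelihood M ρ q.2 q.1 * bregmanDiv f (ρ q.1) (κ q.2)) ((π : Measure Θ).prod ν) :=
    fun hκ => Integrable.of_bound (hmeas hκ).aestronglyMeasurable C
      (Eventually.of_forall fun q => hC _ _ _ _)
  have hx : ∀ {κ : X → DensityMatrix n}, IsEstimator κ → ∀ θ, Integrable (fun x =>
      likelihood M ρ x θ * bregmanDiv f (ρ θ) (κ x)) ν := fun hκ θ =>
    Integrable.of_bound (hM.measurable_risk_integrand hf1 θ hκ).aestronglyMeasurable C
      (Eventually.of_forall fun q => hC _ _ _ _)
  rw [← sub_nonneg, ← integral_sub ((hM.continuous_risk hρ hf1 hτ).integrable_probabilityMeasure π)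
    ((hM.continuous_risk hρ hf1 hS).integrable_probabilityMeasure π)]
  have h : ∀ θ, risk P f (ρ θ) τ - risk P f (ρ θ) S =
      ∫ x, (likelihood M ρ x θ * bregmanDiv f (ρ θ) (τ x) -
        likelihood M ρ x θ * bregmanDiv f (ρ θ) (S x)) ∂ν := fun θ => by
    rw [hM.risk_eq, hM.risk_eq, integral_sub (hx hτ θ) (hx hS θ)]
  simp only [h]
  rw [integral_integral_swap ((hint hτ).sub (hint hS))]
  refine integral_nonneg fun x => ?_
  simp only [← mul_sub]
  exact integral_likelihood_mul_bregmanDiv_sub_nonneg hM.posSemidef hρ hf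
    (hf1.differentiableOn one_ne_zero) ρ₀ π x (τ x)

end bayes

/-! ### Mixtures of priors -/

section mixture

variable {Θ : Type*} [MeasurableSpace Θ]

/-- The mixture `a μ + b τ` of two probability measures with weights `a + b = 1`. -/
noncomputable def mixture {a b : ℝ≥0∞} (h : a + b = 1) (μ τ : ProbabilityMeasure Θ) :
    ProbabilityMeasure Θ :=
  ⟨a • (μ : Measure Θ) + b • (τ : Measure Θ), ⟨by simp [h]⟩⟩

theorem coe_mixture {a b : ℝ≥0∞} (h : a + b = 1) (μ τ : ProbabilityMeasure Θ) :
    (mixture h μ τ : Measure Θ) = a • (μ : Measure Θ) + b • (τ : Measure Θ) := rfl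

theorem integral_mixture {a b : ℝ≥0∞} (h : a + b = 1) (μ τ : ProbabilityMeasure Θ) {g : Θ → ℝ}
    (hμ : Integrable g (μ : Measure Θ)) (hτ : Integrable g (τ : Measure Θ)) :
    ∫ θ, g θ ∂(mixture h μ τ : Measure Θ) =
      a.toReal * ∫ θ, g θ ∂(μ : Measure Θ) + b.toReal * ∫ θ, g θ ∂(τ : Measure Θ) := by
  have ha : a ≠ ∞ := fun h0 => by simp [h0] at h
  have hb : b ≠ ∞ := fun h0 => by simp [h0] at h
  rw [coe_mixture, integral_add_measure (hμ.smul_measure ha) (hτ.smul_measure hb),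
    integral_smul_measure, integral_smul_measure, smul_eq_mul, smul_eq_mul]

theorem regularizedPriors_mono (μ : ProbabilityMeasure Θ) {j k : ℕ} (hjk : j ≤ k) :
    regularizedPriors μ (j + 1) ⊆ regularizedPriors μ (k + 1) := by
  rcases hjk.eq_or_lt with rfl | hlt
  · exact subset_rfl
  rintro π ⟨τ, hπ⟩
  set a : ℝ≥0∞ := ((j + 1 : ℕ) : ℝ≥0∞)⁻¹ with ha
  set a' : ℝ≥0∞ := ((k + 1 : ℕ) : ℝ≥0∞)⁻¹ with ha'
  have haa' : a' ≤ a := ENNReal.inv_le_inv.mpr (by exact_mod_cast Nat.succ_le_succ hjk)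
  have ha1 : a ≤ 1 := ENNReal.inv_le_one.mpr (by exact_mod_cast Nat.succ_le_succ j.zero_le)
  have hlt1 : a' < 1 := ENNReal.inv_lt_one.mpr (by exact_mod_cast Nat.succ_lt_succ (by omega))
  have h0 : 1 - a' ≠ 0 := (tsub_pos_of_lt hlt1).ne'
  have hfin : 1 - a' ≠ ∞ := ENNReal.sub_ne_top ENNReal.one_ne_top
  have hw : (a - a') / (1 - a') + (1 - a) / (1 - a') = 1 := by
    rw [ENNReal.div_add_div_same, add_comm, tsub_add_tsub_cancel ha1 haa',
      ENNReal.div_self h0 hfin]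
  refine ⟨mixture hw μ τ, ?_⟩
  rw [hπ, coe_mixture, smul_add, smul_smul, smul_smul, ENNReal.mul_div_cancel h0 hfin,
    ENNReal.mul_div_cancel h0 hfin, ← add_assoc, ← add_smul, add_tsub_cancel_of_le haa']

theorem inv_add_one_sub_inv (k : ℕ) :
    ((k + 1 : ℕ) : ℝ≥0∞)⁻¹ + (1 - ((k + 1 : ℕ) : ℝ≥0∞)⁻¹) = 1 :=
  add_tsub_cancel_of_le (ENNReal.inv_le_one.mpr (by exact_mod_cast Nat.succ_le_succ k.zero_le))

variable [MetricSpace Θ] [CompactSpace Θ] [BorelSpace Θ]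

theorem tendsto_integral_of_tendsto {ι : Type*} {l : Filter ι} {π : ι → ProbabilityMeasure Θ}
    {π₀ : ProbabilityMeasure Θ} (h : Tendsto π l (𝓝 π₀)) {g : Θ → ℝ} (hg : Continuous g) :
    Tendsto (fun k => ∫ θ, g θ ∂(π k : Measure Θ)) l (𝓝 (∫ θ, g θ ∂(π₀ : Measure Θ))) :=
  ProbabilityMeasure.tendsto_iff_forall_integral_tendsto.mp h
    (BoundedContinuousFunction.mkOfCompact ⟨g, hg⟩)

theorem continuous_mixture {a b : ℝ≥0∞} (h : a + b = 1) (μ : ProbabilityMeasure Θ) :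
    Continuous fun τ : ProbabilityMeasure Θ => mixture h μ τ := by
  refine continuous_iff_continuousAt.mpr fun τ => ?_
  refine ProbabilityMeasure.tendsto_iff_forall_integral_tendsto.mpr fun g => ?_
  have hg := fun π : ProbabilityMeasure Θ => g.continuous.integrable_probabilityMeasure π
  simp only [integral_mixture h μ _ (hg μ) (hg _)]
  exact ((tendsto_integral_of_tendsto tendsto_id g.continuous).const_mul _).const_add _

theorem tendsto_mixture {a b : ℕ → ℝ≥0∞} (h : ∀ k, a k + b k = 1)
    (ha : Tendsto (fun k => (a k).toReal) atTop (𝓝 0)) (μ τ : ProbabilityMeasure Θ) :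
    Tendsto (fun k => mixture (h k) μ τ) atTop (𝓝 τ) := by
  refine ProbabilityMeasure.tendsto_iff_forall_integral_tendsto.mpr fun g => ?_
  have hg := fun π : ProbabilityMeasure Θ => g.continuous.integrable_probabilityMeasure π
  simp only [integral_mixture _ μ τ (hg μ) (hg τ)]
  have hb : Tendsto (fun k => (b k).toReal) atTop (𝓝 1) := by
    have : ∀ k, (b k).toReal = 1 - (a k).toReal := fun k => by
      have hk := congrArg ENNReal.toReal (h k)
      rw [ENNReal.toReal_add (fun h0 => by simpa [h0] using h k)
        (fun h0 => by simpa [h0] using h k), ENNReal.toReal_one] at hk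
      linarith
    simp only [this]
    simpa using ha.const_sub 1
  simpa using (ha.mul_const (∫ θ, g θ ∂(μ : Measure Θ))).add
    (hb.mul_const (∫ θ, g θ ∂(τ : Measure Θ)))

theorem tendsto_toReal_inv_natCast_add_one :
    Tendsto (fun k : ℕ => (((k + 1 : ℕ) : ℝ≥0∞)⁻¹).toReal) atTop (𝓝 0) := by
  simp only [ENNReal.toReal_inv, ENNReal.toReal_natCast]
  simpa [one_div] using tendsto_one_div_add_atTop_nhds_zero_nat (𝕜 := ℝ)

end mixture

/-! ### Regularizing priors -/

section regularizing

variable {n X Θ : Type*} [Fintype n] [DecidableEq n] [MetricSpace Θ] [CompactSpace Θ]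
  [MeasurableSpace Θ] [BorelSpace Θ] {M : X → Matrix n n ℂ} {ρ : Θ → DensityMatrix n}

theorem exists_isOpenPosMeasure (Θ : Type*) [MetricSpace Θ] [CompactSpace Θ] [Nonempty Θ]
    [MeasurableSpace Θ] [BorelSpace Θ] :
    ∃ μ : ProbabilityMeasure Θ, (μ : Measure Θ).IsOpenPosMeasure := by
  let m : Measure Θ := Measure.sum fun k : ℕ =>
    (2⁻¹ : ℝ≥0∞) ^ (k + 1) • Measure.dirac (TopologicalSpace.denseSeq Θ k)
  have hm : IsProbabilityMeasure m := ⟨by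
    simp [m, Measure.sum_apply _ MeasurableSet.univ, ENNReal.tsum_geometric_add_one,
      ENNReal.inv_mul_cancel]⟩
  refine ⟨⟨m, hm⟩, ⟨fun U hU hne => ?_⟩⟩
  obtain ⟨k, hxU⟩ := (TopologicalSpace.denseRange_denseSeq Θ).exists_mem_open hU hne
  change m U ≠ 0
  rw [Measure.sum_apply _ hU.measurableSet]
  refine fun h => ?_
  have := ENNReal.tsum_eq_zero.mp h k
  simp [hxU] at this

theorem exists_isRegularizing [Nonempty Θ] (hM : ∀ x, (M x).PosSemidef) (hρ : Continuous ρ) :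
    ∃ μ : ProbabilityMeasure Θ, IsRegularizing M ρ μ := by
  obtain ⟨μ, hμ⟩ := exists_isOpenPosMeasure Θ
  refine ⟨μ, fun x ⟨θ, hθ⟩ => ?_⟩
  exact (continuous_likelihood hρ x).integral_pos_of_hasCompactSupport_nonneg_nonzero
    (HasCompactSupport.of_compactSpace _) (fun θ => likelihood_nonneg hM x θ) hθ.ne'

theorem posteriorMap_eq_zero_of_likelihood (hM : ∀ x, (M x).PosSemidef) (hρ : Continuous ρ)
    {x : X} (hx : ¬ ∃ θ, 0 < likelihood M ρ x θ) (π : ProbabilityMeasure Θ) :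
    posteriorMap ρ π (M x) = 0 := by
  have h : ∀ θ, likelihood M ρ x θ = 0 := fun θ =>
    le_antisymm (not_lt.mp fun h0 => hx ⟨θ, h0⟩) (likelihood_nonneg hM x θ)
  rw [posteriorMap_eq_zero_iff hM hρ, marginal]
  simp [h]

theorem IsRegularizing.posteriorMap_mixture_ne_zero {μ : ProbabilityMeasure Θ}
    (hμ : IsRegularizing M ρ μ) (hM : ∀ x, (M x).PosSemidef) (hρ : Continuous ρ)
    {a b : ℝ≥0∞} (h : a + b = 1) (ha : a ≠ 0) (τ : ProbabilityMeasure Θ) {x : X}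
    (hx : ∃ θ, 0 < likelihood M ρ x θ) : posteriorMap ρ (mixture h μ τ) (M x) ≠ 0 := by
  have hl := continuous_likelihood (M := M) hρ x
  rw [Ne, posteriorMap_eq_zero_iff hM hρ, marginal,
    integral_mixture h μ τ (hl.integrable_probabilityMeasure μ)
      (hl.integrable_probabilityMeasure τ)]
  have h1 : 0 < a.toReal * ∫ θ, likelihood M ρ x θ ∂(μ : Measure Θ) :=
    mul_pos (ENNReal.toReal_pos ha fun h0 => by simp [h0] at h) (hμ x hx)
  have h2 : 0 ≤ b.toReal * ∫ θ, likelihood M ρ x θ ∂(τ : Measure Θ) :=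
    mul_nonneg ENNReal.toReal_nonneg (integral_nonneg fun θ => likelihood_nonneg hM x θ)
  linarith

theorem IsRegularizing.tendsto_bayesEstimator {μ : ProbabilityMeasure Θ}
    (hμ : IsRegularizing M ρ μ) (hM : ∀ x, (M x).PosSemidef) (hρ : Continuous ρ)
    (ρ₀ : DensityMatrix n) {a b : ℝ≥0∞} (h : a + b = 1) (ha : a ≠ 0)
    {π : ℕ → ProbabilityMeasure Θ} {τ : ProbabilityMeasure Θ}
    (hπ : Tendsto π atTop (𝓝 (mixture h μ τ))) (x : X) :
    Tendsto (fun k => bayesEstimator M ρ ρ₀ (π k) x) atTop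
      (𝓝 (bayesEstimator M ρ ρ₀ (mixture h μ τ) x)) := by
  by_cases hx : ∃ θ, 0 < likelihood M ρ x θ
  · exact tendsto_normalizedState ρ₀ (fun k => posSemidef_posteriorMap hρ (π k) (hM x))
      (hμ.posteriorMap_mixture_ne_zero hM hρ h ha τ hx) (tendsto_posteriorMap hρ hπ (M x))
  · simp only [bayesEstimator, posteriorMap_eq_zero_of_likelihood hM hρ hx]
    exact tendsto_const_nhds

end regularizing

/-! ### Least favourable priors -/

section leastFavourable

variable {n : Type*} [Fintype n] [DecidableEq n] {X : Type*} [MeasurableSpace X]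
  {Θ : Type*} [MetricSpace Θ] [CompactSpace Θ] [MeasurableSpace Θ] [BorelSpace Θ]
  {P : POVM X n} {ν : Measure X} {M : X → Matrix n n ℂ} {ρ : Θ → DensityMatrix n} {f : ℝ → ℝ}

/-- Among the priors `a μ + b τ`, take one that minimizes the advantage in Bayes risk of the Bayes
estimator over `σ`. Its Bayes estimator has an advantage over `σ` under *every* prior of this form.
The minimum exists because the advantage is a maximum, over estimators, of weakly continuous
functions of the prior. -/
theorem POVM.IsDensity.exists_forall_integral_risk_sub_nonneg (hM : P.IsDensity ν M)
    (hρ : Continuous ρ) (hf : ConvexOn ℝ (Icc 0 1) f) (hf1 : ContDiffOn ℝ 1 f (Icc 0 1))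
    (ρ₀ : DensityMatrix n) {μ : ProbabilityMeasure Θ} (hμ : IsRegularizing M ρ μ)
    {a b : ℝ≥0∞} (h : a + b = 1) (ha : a ≠ 0) {σ : X → DensityMatrix n} (hσ : IsEstimator σ) :
    ∃ τ : ProbabilityMeasure Θ, ∀ τ' : ProbabilityMeasure Θ,
      0 ≤ ∫ θ, (risk P f (ρ θ) σ - risk P f (ρ θ) (bayesEstimator M ρ ρ₀ (mixture h μ τ)))
        ∂(mixture h μ τ' : Measure Θ) := by
  set S := bayesEstimator M ρ ρ₀ with hSdef
  -- `A κ π` is the advantage of the estimator `κ` over `σ` in Bayes risk under the prior `π`.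
  set A : (X → DensityMatrix n) → ProbabilityMeasure Θ → ℝ := fun κ π =>
    ∫ θ, (risk P f (ρ θ) σ - risk P f (ρ θ) κ) ∂(π : Measure Θ) with hA
  have hS : ∀ π, IsEstimator (S π) := fun π =>
    (isBayesEstimator_bayesEstimator hM.posSemidef hM.measurable hρ ρ₀ π).1
  have hcont : ∀ {κ}, IsEstimator κ → Continuous fun θ => risk P f (ρ θ) σ - risk P f (ρ θ) κ :=
    fun hκ => (hM.continuous_risk hρ hf1 hσ).sub (hM.continuous_risk hρ hf1 hκ)
  have hbest : ∀ {κ}, IsEstimator κ → ∀ π, A κ π ≤ A (S π) π := fun {κ} hκ π => by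
    have hi := fun {κ : X → DensityMatrix n} (hκ : IsEstimator κ) =>
      (hM.continuous_risk hρ hf1 hκ).integrable_probabilityMeasure π
    simp only [hA]
    rw [integral_sub (hi hσ) (hi hκ), integral_sub (hi hσ) (hi (hS π))]
    exact sub_le_sub_left (hM.integral_risk_bayesEstimator_le hρ hf hf1 ρ₀ π hκ) _
  have hnn : ∀ π, 0 ≤ A (S π) π := fun π => by
    have := hbest hσ π
    simpa [hA] using this
  -- Near `τ` the optimal advantage is bounded below by that of the estimator optimal at `τ`.
  have hlsc : LowerSemicontinuous fun τ => A (S (mixture h μ τ)) (mixture h μ τ) := by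
    intro τ y hy
    have hc : Continuous fun τ' => A (S (mixture h μ τ)) (mixture h μ τ') :=
      continuous_iff_continuousAt.mpr fun τ' =>
        tendsto_integral_of_tendsto ((continuous_mixture h μ).tendsto τ') (hcont (hS _))
    filter_upwards [(hc.tendsto τ).eventually_const_lt hy] with τ' hτ'
    exact hτ'.trans_le (hbest (hS _) _)
  obtain ⟨τ, -, hτ⟩ := (hlsc.lowerSemicontinuousOn univ).exists_isMinOn
    ⟨μ, mem_univ _⟩ isCompact_univ
  refine ⟨τ, fun τ' => (hnn (mixture h μ τ)).trans ?_⟩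
  -- Perturb the minimizer towards `τ'` with weight `w k → 0`.
  let w : ℕ → ℝ≥0∞ := fun k => ((k + 1 : ℕ) : ℝ≥0∞)⁻¹
  have hw : ∀ k, w k + (1 - w k) = 1 := inv_add_one_sub_inv
  have hwpos : ∀ k, 0 < (w k).toReal := fun k => by
    simp only [w, ENNReal.toReal_inv, ENNReal.toReal_natCast]
    positivity
  let π : ℕ → ProbabilityMeasure Θ := fun k => mixture h μ (mixture (hw k) τ' τ)
  have hπ : Tendsto π atTop (𝓝 (mixture h μ τ)) :=
    ((continuous_mixture h μ).tendsto τ).comp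
      (tendsto_mixture hw tendsto_toReal_inv_natCast_add_one τ' τ)
  have hsplit : ∀ {κ}, IsEstimator κ → ∀ k, A κ (π k) =
      (w k).toReal * A κ (mixture h μ τ') + (1 - (w k).toReal) * A κ (mixture h μ τ) := by
    intro κ hκ k
    have hi := fun π => (hcont hκ).integrable_probabilityMeasure π
    have hb : (1 - w k).toReal = 1 - (w k).toReal :=
      ENNReal.toReal_sub_of_le (le_of_le_of_eq le_self_add (hw k)) ENNReal.one_ne_top
    have hab : a.toReal + b.toReal = 1 := by
      rw [← ENNReal.toReal_add (fun h0 => by simp [h0] at h) (fun h0 => by simp [h0] at h), h,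
        ENNReal.toReal_one]
    simp only [hA, π]
    rw [integral_mixture h _ _ (hi _) (hi _), integral_mixture h _ _ (hi _) (hi _),
      integral_mixture h _ _ (hi _) (hi _), integral_mixture (hw k) _ _ (hi _) (hi _), hb]
    ring
  have hle : ∀ k, A (S (mixture h μ τ)) (mixture h μ τ) ≤ A (S (π k)) (mixture h μ τ') := by
    intro k
    have h1 : A (S (mixture h μ τ)) (mixture h μ τ) ≤ A (S (π k)) (π k) :=
      hτ (mem_univ (mixture (hw k) τ' τ))
    have h2 := hbest (hS (π k)) (mixture h μ τ)
    rw [hsplit (hS (π k)) k] at h1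
    have hw1 : (w k).toReal ≤ 1 := by
      have := ENNReal.toReal_mono ENNReal.one_ne_top (le_of_le_of_eq le_self_add (hw k))
      simpa using this
    have h3 := mul_le_mul_of_nonneg_left h2 (sub_nonneg.mpr hw1)
    nlinarith [hwpos k]
  refine ge_of_tendsto' (x := atTop) (f := fun k => A (S (π k)) (mixture h μ τ')) ?_ hle
  obtain ⟨C, hC0, hC⟩ := hM.exists_forall_abs_risk_le ρ hf1
  refine tendsto_integral_of_dominated_convergence (fun _ => C + C)
    (fun k => (hcont (hS _)).aestronglyMeasurable) (integrable_const _)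
    (fun k => Eventually.of_forall fun θ =>
      (norm_sub_le _ _).trans (add_le_add (hC _ _) (hC _ _)))
    (Eventually.of_forall fun θ => ?_)
  exact (hM.tendsto_risk hf1 (fun k => hS (π k))
    (fun x => hμ.tendsto_bayesEstimator hM.posSemidef hρ ρ₀ h ha hπ x) θ).const_sub _

end leastFavourable

/-! ### Existence of operator densities -/

section density

variable {X : Type*} [MeasurableSpace X]

theorem ae_nonneg_of_forall_setIntegral_complex_nonneg {ν : Measure X} {g : X → ℂ}
    (hg : Integrable g ν) (h : ∀ B, MeasurableSet B → 0 ≤ ∫ x in B, g x ∂ν) :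
    ∀ᵐ x ∂ν, 0 ≤ g x := by
  have hre : 0 ≤ᵐ[ν] fun x => (g x).re :=
    ae_nonneg_of_forall_setIntegral_nonneg hg.re fun B hB _ => by
      have := (Complex.nonneg_iff.mp (h B hB)).1
      rwa [← RCLike.re_eq_complex_re, ← integral_re hg.integrableOn] at this
  have him : (fun x => (g x).im) =ᵐ[ν] 0 :=
    hg.im.ae_eq_zero_of_forall_setIntegral_eq_zero fun B hB _ => by
      have := (Complex.nonneg_iff.mp (h B hB)).2.symm
      rwa [← RCLike.im_eq_complex_im, ← integral_im hg.integrableOn] at this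
  filter_upwards [hre, him] with x h1 h2
  exact Complex.nonneg_iff.mpr ⟨h1, h2.symm⟩

theorem MeasureTheory.SignedMeasure.setIntegral_rnDeriv {ν : Measure X} [IsFiniteMeasure ν]
    {s : SignedMeasure X} (hs : ∀ B, MeasurableSet B → ν B = 0 → s B = 0) {B : Set X}
    (hB : MeasurableSet B) : ∫ x in B, s.rnDeriv ν x ∂ν = s B := by
  have hac : s ≪ᵥ ν.toENNRealVectorMeasure := VectorMeasure.AbsolutelyContinuous.mk
    fun C hC h0 => hs C hC (by rwa [Measure.toENNRealVectorMeasure_apply_measurable hC] at h0)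
  have h := SignedMeasure.absolutelyContinuous_iff_withDensityᵥ_rnDeriv_eq s ν |>.mp hac
  conv_rhs => rw [← h]
  rw [withDensityᵥ_apply (SignedMeasure.integrable_rnDeriv s ν) hB]

variable {n : Type*} [Fintype n] [DecidableEq n]

/-- A POVM is absolutely continuous with respect to the outcome law of the maximally mixed state,
because a positive semidefinite matrix of trace zero vanishes. -/
theorem POVM.exists_isDensity [Nonempty n] (P : POVM X n) :
    ∃ (ν : Measure X) (M : X → Matrix n n ℂ), P.IsDensity ν M := by
  have hcard : (Fintype.card n : ℂ) ≠ 0 := by simp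
  -- The reference measure is the law of the outcome in the maximally mixed state.
  let ω : DensityMatrix n := ⟨(Fintype.card n : ℂ)⁻¹ • 1,
    Matrix.PosSemidef.one.smul (inv_nonneg.mpr (Nat.cast_nonneg _)), by
      rw [Matrix.trace_smul, Matrix.trace_one, smul_eq_mul, inv_mul_cancel₀ hcard]⟩
  set ν := P.born ω with hν
  have hνB : ∀ B, MeasurableSet B →
      ν B = ENNReal.ofReal ((Fintype.card n : ℝ)⁻¹ * (P.toVectorMeasure B).trace.re) :=
    fun B hB => by
      rw [hν, POVM.born, Measure.ofMeasurable_apply _ hB]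
      congr 1
      have : (Fintype.card n : ℂ)⁻¹ = (((Fintype.card n : ℝ)⁻¹ : ℝ) : ℂ) := by push_cast; rfl
      simp only [ω, Matrix.mul_smul, mul_one, Matrix.trace_smul, smul_eq_mul]
      rw [this, Complex.re_ofReal_mul]
  have hprob : IsProbabilityMeasure ν := ⟨by
    rw [hνB _ MeasurableSet.univ, P.univ_eq_one]
    simp⟩
  have hnull : ∀ B, MeasurableSet B → ν B = 0 → P.toVectorMeasure B = 0 := fun B hB h0 => by
    have hp := P.posSemidef B hB
    rw [hνB B hB, ENNReal.ofReal_eq_zero] at h0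
    have hc : (0 : ℝ) < (Fintype.card n : ℝ)⁻¹ := by positivity
    have h1 : (P.toVectorMeasure B).trace.re ≤ 0 := by
      by_contra hlt
      exact absurd h0 (not_le.mpr (mul_pos hc (not_le.mp hlt)))
    have h2 := Complex.nonneg_iff.mp hp.trace_nonneg
    exact hp.trace_eq_zero_iff.mp (Complex.ext (le_antisymm h1 h2.1) h2.2.symm)
  -- The Radon–Nikodym derivatives of the real and imaginary parts of the entries.
  let reEntry : n → n → Matrix n n ℂ →+ ℝ := fun i j =>
    { toFun := fun A => (A i j).re, map_zero' := by simp, map_add' := by simp }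
  let imEntry : n → n → Matrix n n ℂ →+ ℝ := fun i j =>
    { toFun := fun A => (A i j).im, map_zero' := by simp, map_add' := by simp }
  have hreC : ∀ i j, Continuous (reEntry i j) := fun i j =>
    Complex.continuous_re.comp (continuous_id.matrix_elem i j)
  have himC : ∀ i j, Continuous (imEntry i j) := fun i j =>
    Complex.continuous_im.comp (continuous_id.matrix_elem i j)
  let r : n → n → SignedMeasure X := fun i j => P.toVectorMeasure.mapRange _ (hreC i j)
  let s : n → n → SignedMeasure X := fun i j => P.toVectorMeasure.mapRange _ (himC i j)
  let N : X → Matrix n n ℂ := fun x => Matrix.of fun i j =>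
    ((r i j).rnDeriv ν x : ℂ) + ((s i j).rnDeriv ν x : ℂ) * Complex.I
  have hNmeas : ∀ i j, Measurable fun x => N x i j := fun i j =>
    (Complex.measurable_ofReal.comp (SignedMeasure.measurable_rnDeriv _ ν)).add
      ((Complex.measurable_ofReal.comp (SignedMeasure.measurable_rnDeriv _ ν)).mul_const _)
  have hri : ∀ i j, Integrable (fun x => ((r i j).rnDeriv ν x : ℂ)) ν := fun i j =>
    (SignedMeasure.integrable_rnDeriv _ ν).ofReal
  have hsi : ∀ i j, Integrable (fun x => ((s i j).rnDeriv ν x : ℂ) * Complex.I) ν := fun i j =>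
    (SignedMeasure.integrable_rnDeriv _ ν).ofReal.mul_const _
  have hNint : ∀ i j, Integrable (fun x => N x i j) ν := fun i j => (hri i j).add (hsi i j)
  have hNB : ∀ B, MeasurableSet B → ∀ i j,
      ∫ x in B, N x i j ∂ν = P.toVectorMeasure B i j := fun B hB i j => by
    have h1 : ∫ x in B, (r i j).rnDeriv ν x ∂ν = (P.toVectorMeasure B i j).re :=
      SignedMeasure.setIntegral_rnDeriv (fun C hC h0 => by simp [r, hnull C hC h0]) hB
    have h2 : ∫ x in B, (s i j).rnDeriv ν x ∂ν = (P.toVectorMeasure B i j).im :=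
      SignedMeasure.setIntegral_rnDeriv (fun C hC h0 => by simp [s, hnull C hC h0]) hB
    calc ∫ x in B, N x i j ∂ν
        = ∫ x in B, ((r i j).rnDeriv ν x : ℂ) + ((s i j).rnDeriv ν x : ℂ) * Complex.I ∂ν := rfl
      _ = _ := by
        rw [integral_add (hri i j).integrableOn (hsi i j).integrableOn, integral_mul_const,
          integral_complex_ofReal, integral_complex_ofReal, h1, h2, Complex.re_add_im]
  have hquad : ∀ v : n → ℂ, ∀ᵐ x ∂ν, 0 ≤ star v ⬝ᵥ (N x *ᵥ v) := fun v => by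
    have hterm : ∀ i j, Integrable (fun x => star (v i) * (N x i j * v j)) ν := fun i j =>
      ((hNint i j).mul_const _).const_mul _
    have hexp : ∀ A : Matrix n n ℂ,
        star v ⬝ᵥ (A *ᵥ v) = ∑ i, ∑ j, star (v i) * (A i j * v j) := fun A => by
      simp [dotProduct, Matrix.mulVec, Finset.mul_sum]
    simp only [hexp]
    refine ae_nonneg_of_forall_setIntegral_complex_nonneg
      (integrable_finsetSum _ fun i _ => integrable_finsetSum _ fun j _ => hterm i j)
      fun B hB => ?_
    have h := (P.posSemidef B hB).dotProduct_mulVec_nonneg v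
    rw [hexp] at h
    convert! h using 1
    rw [integral_finsetSum _ fun i _ => integrable_finsetSum _ fun j _ => (hterm i j).integrableOn]
    refine Finset.sum_congr rfl fun i _ => ?_
    rw [integral_finsetSum _ fun j _ => (hterm i j).integrableOn]
    refine Finset.sum_congr rfl fun j _ => ?_
    rw [integral_const_mul, integral_mul_const, hNB B hB]
  have hpsd : ∀ᵐ x ∂ν, (N x).PosSemidef := by
    filter_upwards [ae_all_iff.mpr fun k => hquad (TopologicalSpace.denseSeq (n → ℂ) k)] with x hx
    refine Matrix.posSemidef_of_forall_dotProduct_mulVec_nonneg fun v => ?_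
    refine (TopologicalSpace.denseRange_denseSeq (n → ℂ)).induction_on v
      (isClosed_le continuous_const ?_) hx
    fun_prop
  have htr : ∀ᵐ x ∂ν, (N x).trace = (Fintype.card n : ℂ) := by
    have hi : Integrable (fun x => (N x).trace) ν := integrable_finsetSum _ fun i _ => hNint i i
    refine hi.ae_eq_of_forall_setIntegral_eq _ _ (integrable_const _) fun B hB _ => ?_
    have h1 : ∫ x in B, (N x).trace ∂ν = (P.toVectorMeasure B).trace := by
      simp only [Matrix.trace, Matrix.diag]
      rw [integral_finsetSum _ fun i _ => (hNint i i).integrableOn]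
      exact Finset.sum_congr rfl fun i _ => hNB B hB i i
    have h2 := Complex.nonneg_iff.mp (P.posSemidef B hB).trace_nonneg
    rw [h1, setIntegral_const, measureReal_def, hνB B hB,
      ENNReal.toReal_ofReal (mul_nonneg (by positivity) h2.1)]
    refine Complex.ext ?_ ?_
    · simp
      field_simp
    · simp [← h2.2]
  -- Redefine the density on a null set so that the constraints hold everywhere.
  obtain ⟨Z, hsub, hZ, hZ0⟩ := exists_measurable_superset_of_null (ae_iff.mp (hpsd.and htr))
  have hgood : ∀ x ∉ Z, (N x).PosSemidef ∧ (N x).trace = (Fintype.card n : ℂ) := fun x hx => by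
    by_contra hbad
    exact hx (hsub hbad)
  classical
  refine ⟨ν, fun x => if x ∈ Z then 1 else N x, hprob, fun i j => ?_, fun x => ?_, fun x => ?_,
    fun B hB i j => ?_⟩
  · have : (fun x => (if x ∈ Z then (1 : Matrix n n ℂ) else N x) i j) =
        fun x => if x ∈ Z then (1 : Matrix n n ℂ) i j else N x i j := by
      funext x
      split_ifs <;> rfl
    rw [this]
    exact Measurable.ite hZ measurable_const (hNmeas i j)
  · split_ifs with hx
    exacts [Matrix.PosSemidef.one, (hgood x hx).1]
  · split_ifs with hx
    exacts [Matrix.trace_one, (hgood x hx).2]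
  · rw [← hNB B hB]
    refine integral_congr_ae (ae_restrict_of_ae ?_)
    filter_upwards [compl_mem_ae_iff.mpr hZ0] with x hx
    rw [if_neg hx]

end density

/-! ### Limits of Bayes estimators -/

/-- A subsequence can be slowed down, by repeating its terms, so that its `k`-th index is at most
`k`. -/
theorem StrictMono.exists_le_tendsto_map {φ : ℕ → ℕ} (hφ : StrictMono φ) :
    ∃ m : ℕ → ℕ, (∀ k, m k ≤ k) ∧ Tendsto m atTop (map φ atTop) := by
  classical
  let j : ℕ → ℕ := fun k => Nat.findGreatest (fun i => φ i ≤ k) k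
  refine ⟨fun k => if φ 0 ≤ k then φ (j k) else 0, fun k => ?_, ?_⟩
  · simp only
    split_ifs with h
    · exact Nat.findGreatest_spec (P := fun i => φ i ≤ k) (Nat.zero_le k) h
    · exact Nat.zero_le k
  · have hj : Tendsto j atTop atTop := Filter.tendsto_atTop.mpr fun i => by
      filter_upwards [eventually_ge_atTop (φ i)] with k hk
      exact Nat.le_findGreatest ((hφ.id_le i).trans hk) hk
    refine (tendsto_map.comp hj).congr' ?_
    filter_upwards [eventually_ge_atTop (φ 0)] with k hk
    simp [hk]

section limit

variable {n X Θ : Type*} [Fintype n] [DecidableEq n] [MetricSpace Θ] [CompactSpace Θ]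
  [MeasurableSpace Θ] [BorelSpace Θ] {M : X → Matrix n n ℂ} {ρ : Θ → DensityMatrix n}

open scoped Matrix.Norms.L2Operator in
/-- A sequence of priors under which each outcome of positive likelihood keeps positive probability
has a weakly convergent subsequence along which the Bayes estimators converge at *every* outcome,
including those that have probability zero under the limiting prior. -/
theorem exists_subseq_tendsto_bayesEstimator (hM : ∀ x, (M x).PosSemidef) (hρ : Continuous ρ)
    (ρ₀ : DensityMatrix n) (π : ℕ → ProbabilityMeasure Θ)
    (hπ : ∀ k x, (∃ θ, 0 < likelihood M ρ x θ) → posteriorMap ρ (π k) (M x) ≠ 0) :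
    ∃ φ : ℕ → ℕ, StrictMono φ ∧ (∃ π', Tendsto (π ∘ φ) atTop (𝓝 π')) ∧
      ∀ x, ∃ ω, Tendsto (fun k => bayesEstimator M ρ ρ₀ (π (φ k)) x) atTop (𝓝 ω) := by
  obtain ⟨π', φ₁, hφ₁, hlim⟩ := CompactSpace.tendsto_subseq π
  obtain ⟨φ₂, hφ₂, h⟩ := exists_subseq_forall_tendsto_smul _ (Matrix n n ℂ) rfl
    fun k => LinearMap.toContinuousLinearMap (posteriorMap ρ (π (φ₁ k)))
  refine ⟨φ₁ ∘ φ₂, hφ₁.comp hφ₂, ⟨π', hlim.comp hφ₂.tendsto_atTop⟩, fun x => ?_⟩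
  have hpos := fun k => posSemidef_posteriorMap hρ (π (φ₁ (φ₂ k))) (hM x)
  by_cases hx : ∃ θ, 0 < likelihood M ρ x θ
  · obtain h0 | ⟨c, hc, y, hy, hlim'⟩ := h (M x)
    · exact absurd (h0 0) (hπ _ x hx)
    · refine ⟨normalizedState ρ₀ y, ?_⟩
      refine (tendsto_normalizedState ρ₀ (A := fun k => (c k : ℂ) •
        posteriorMap ρ (π (φ₁ (φ₂ k))) (M x)) (fun k => (hpos k).smul ?_) hy hlim').congr
        fun k => normalizedState_smul ρ₀ (hpos k) (hc k)
      exact_mod_cast (hc k).le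
  · refine ⟨ρ₀, ?_⟩
    simp only [bayesEstimator, posteriorMap_eq_zero_of_likelihood hM hρ hx, normalizedState_zero]
    exact tendsto_const_nhds

end limit

theorem mainTheorem1 {n : Type*} [Fintype n] [DecidableEq n]
    {X : Type*} [MeasurableSpace X]
    {Θ : Type*} [MetricSpace Θ] [CompactSpace Θ] [Nonempty Θ] [MeasurableSpace Θ] [BorelSpace Θ]
    (P : POVM X n) (ρ : Θ → DensityMatrix n) (hρ : Continuous ρ)
    (f : ℝ → ℝ) (hf_convex : StrictConvexOn ℝ (Icc 0 1) f) (hf_C1 : ContDiffOn ℝ 1 f (Icc 0 1)) :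
    (∃ (ν : Measure X) (M : X → Matrix n n ℂ), P.IsDensity ν M) ∧
    ∀ (ν : Measure X) (M : X → Matrix n n ℂ), P.IsDensity ν M →
      (∃ μ : ProbabilityMeasure Θ, IsRegularizing M ρ μ) ∧
      ∀ μ : ProbabilityMeasure Θ, IsRegularizing M ρ μ →
        ∀ σ : X → DensityMatrix n, IsEstimator σ →
          ∃ (π : ℕ → ProbabilityMeasure Θ) (πlim : ProbabilityMeasure Θ)
            (σB : ℕ → X → DensityMatrix n) (σlim : X → DensityMatrix n),
            (∀ k, π k ∈ regularizedPriors μ (k + 1)) ∧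
            Tendsto π atTop (𝓝 πlim) ∧
            (∀ k, IsBayesEstimator M ρ (π k) (σB k)) ∧
            IsEstimator σlim ∧
            (∀ x, Tendsto (fun k => σB k x) atTop (𝓝 (σlim x))) ∧
            ∀ θ, risk P f (ρ θ) σlim ≤ risk P f (ρ θ) σ := by
  obtain ⟨θ₀⟩ := ‹Nonempty Θ›
  have hn : Nonempty n := by
    by_contra h
    have := not_nonempty_iff.mp h
    simpa [Matrix.trace] using (ρ θ₀).2.2
  refine ⟨P.exists_isDensity, fun ν M hM => ⟨exists_isRegularizing hM.posSemidef hρ,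
    fun μ hμ σ hσ => ?_⟩⟩
  let S := bayesEstimator M ρ (ρ θ₀)
  have hS : ∀ π, IsBayesEstimator M ρ π (S π) :=
    isBayesEstimator_bayesEstimator hM.posSemidef hM.measurable hρ (ρ θ₀)
  let w : ℕ → ℝ≥0∞ := fun k => ((k + 1 : ℕ) : ℝ≥0∞)⁻¹
  have hw : ∀ k, w k + (1 - w k) = 1 := inv_add_one_sub_inv
  have hw0 : ∀ k, w k ≠ 0 := fun k => ENNReal.inv_ne_zero.mpr (ENNReal.natCast_ne_top _)
  choose τ hτ using fun k => hM.exists_forall_integral_risk_sub_nonneg hρ hf_convex.convexOn hf_C1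
    (ρ θ₀) hμ (hw k) (hw0 k) hσ
  let π : ℕ → ProbabilityMeasure Θ := fun k => mixture (hw k) μ (τ k)
  obtain ⟨φ, hφ, ⟨π', hπ'⟩, hlim⟩ := exists_subseq_tendsto_bayesEstimator hM.posSemidef hρ (ρ θ₀) π
    fun k x hx => hμ.posteriorMap_mixture_ne_zero hM.posSemidef hρ (hw k) (hw0 k) (τ k) hx
  choose σ' hσ' using hlim
  obtain ⟨m, hmk, hm⟩ := hφ.exists_le_tendsto_map
  have hm_top : Tendsto m atTop atTop := hm.mono_right hφ.tendsto_atTop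
  have hlim_m : ∀ x, Tendsto (fun k => S (π (m k)) x) atTop (𝓝 (σ' x)) := fun x =>
    (tendsto_map'_iff.mpr (hσ' x) : Tendsto (fun k => S (π k) x) (map φ atTop) _).comp hm
  have hest : ∀ k, IsEstimator (S (π (m k))) := fun k => (hS _).1
  refine ⟨π ∘ m, π', fun k => S (π (m k)), σ',
    fun k => regularizedPriors_mono μ (hmk k) ⟨τ (m k), rfl⟩,
    (tendsto_map'_iff.mpr hπ').comp hm, fun k => hS _, isEstimator_of_tendsto hest hlim_m, hlim_m,
    fun θ => ?_⟩
  obtain ⟨C, hC0, hC⟩ := hM.exists_forall_abs_risk_le ρ hf_C1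
  -- Test the optimality of `π k` against the point mass at `θ`.
  have hbound : ∀ k, -((w k).toReal * (C + C)) ≤
      (1 - (w k).toReal) * (risk P f (ρ θ) σ - risk P f (ρ θ) (S (π k))) := fun k => by
    have hcont : Continuous fun θ => risk P f (ρ θ) σ - risk P f (ρ θ) (S (π k)) :=
      (hM.continuous_risk hρ hf_C1 hσ).sub (hM.continuous_risk hρ hf_C1 (hS _).1)
    have h := hτ k (diracProba θ)
    rw [integral_mixture (hw k) _ _ (hcont.integrable_probabilityMeasure _)
      (hcont.integrable_probabilityMeasure _), ENNReal.toReal_sub_of_le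
      (le_of_le_of_eq le_self_add (hw k)) ENNReal.one_ne_top, ENNReal.toReal_one] at h
    have hdirac : ∫ θ', (risk P f (ρ θ') σ - risk P f (ρ θ') (S (π k)))
        ∂(diracProba θ : Measure Θ) = risk P f (ρ θ) σ - risk P f (ρ θ) (S (π k)) :=
      integral_dirac _ θ
    have hI : ∫ θ', (risk P f (ρ θ') σ - risk P f (ρ θ') (S (π k))) ∂(μ : Measure Θ) ≤ C + C := by
      have := norm_integral_le_of_norm_le_const (μ := (μ : Measure Θ)) (C := C + C)
        (Eventually.of_forall fun θ' => (norm_sub_le (risk P f (ρ θ') σ)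
          (risk P f (ρ θ') (S (π k)))).trans (add_le_add (hC θ' σ) (hC θ' (S (π k)))))
      simpa using (le_abs_self _).trans this
    have h2 := mul_le_mul_of_nonneg_left hI (ENNReal.toReal_nonneg (a := w k))
    rw [hdirac] at h
    linarith
  have hw_lim : Tendsto (fun k => (w (m k)).toReal) atTop (𝓝 0) :=
    tendsto_toReal_inv_natCast_add_one.comp hm_top
  have hl : Tendsto (fun k => -((w (m k)).toReal * (C + C))) atTop (𝓝 0) := by
    simpa using (hw_lim.mul_const (C + C)).neg
  have hr : Tendsto (fun k => (1 - (w (m k)).toReal) *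
      (risk P f (ρ θ) σ - risk P f (ρ θ) (S (π (m k))))) atTop
      (𝓝 (risk P f (ρ θ) σ - risk P f (ρ θ) σ')) := by
    simpa using (hw_lim.const_sub 1).mul ((hM.tendsto_risk hf_C1 hest hlim_m θ).const_sub _)
  exact sub_nonneg.mp (le_of_tendsto_of_tendsto' hl hr fun k => hbound (m k))
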